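/- **Setting.** $N\ge 2$ workers minimize $f=\frac1N\sum_{i=1}^N f_i$ over $\mathbb R^{p\times q}$ (Frobenius norm and inner product), where $f_i(X)=\mathbb E_{\xi\sim D_i}F_i(X,\xi)$. From a common initial model $X_i^{(0)}=X^{(0)}$, with stepsizes $\eta_t>0$, every round $t\ge1$ performs $$Y_i^{(t)}=X_i^{(t-1)}-\eta_t\nabla F_i(X_i^{(t-1)},\xi_{i,t}),\qquad X_i^{(t)}=Y_i^{(t)}+\sum_{j\in\mathcal N_i}W_{ij}\bigl(\mathcal C^{(t)}_{ij}(Y_j^{(t)})-\mathcal C^{(t)}_{ij}(Y_i^{(t)})\bigr),$$ where $\mathcal N_i$ is the set of neighbours of $i$ in an undirected graph on the workers. After $T$ rounds, $X_i^{\rm out}=X_i^{(t)}$ for all $i$, with one common random index $t\in\{0,\dots,T\}$, drawn independently of the run with probability proportional to given weights $\alpha_t\ge 0$; $\bar X^{\rm out}=\frac1N\sum_iX_i^{\rm out}$. **Assumptions**, with constants $L,\sigma,\zeta\ge0$ and $\rho,\delta>0$. - Each $f_i$ is differentiable with $L$-Lipschitz gradient. - In each round the $\xi_{i,t}\sim D_i$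 are independent across $i$ and independent of the past. For all $X$: $\mathbb E_{\xi\sim D_i}\nabla F_i(X,\xi)=\nabla f_i(X)$, $\ \mathbb E_{\xi\sim D_i}\|\nabla F_i(X,\xi)-\nabla f_i(X)\|^2\le\sigma^2$, and $\frac1N\sum_i\|\nabla f_i(X)-\nabla f(X)\|^2\le\zeta^2$. - $W\in\mathbb R^{N\times N}$ is symmetric and doubly stochastic (with nonnegative entries), $W_{ij}\ne0$ for $i\neq j$ only if $ij$ is an edge, and $W^2$ has spectral gap $\rho=1-\lambda_2^2>0$, where $\lambda_2^2$ is the second largest eigenvalue of $W^2$ counted with multiplicity. - Every compressor on an edge is almost surely a linear orthogonal projection, $\mathcal C_{ij}^{(t)}=\mathcal C_{ji}^{(t)}$, and given the past rounds and the samples of round $t$, $\mathbb E[\mathcal C^{(t)}_{ij}(X)]=\delta X$ for every $X$. The compressors on different edges may be arbitrarily dependent. For $\mu\ge0$, say that $\{f_i\}$ is $\mu$-convex if for all $i$, all $X$ and every minimizer $X^\star$ of $f$: $\langle\nabla f_i(X),X^\star-X\rangle\le-\bigl(f_i(X)-f_i(X^\star)+\frac\mu2\|X-X^\star\|^2\bigr)$.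 **Theorem.** There is a universal constant $c>0$ such that for every $\varepsilon>0$, in each of the following cases there are stepsizes $\{\eta_t\}$ and weights $\{\alpha_t\}$, depending only on $\varepsilon$ and on the constants $N,L,\sigma,\zeta,\rho,\delta$ and $\Delta_0$ (respectively $R$; respectively $\mu$ and $R$), such that the stated bound holds for every number of rounds $T$ that satisfies the stated inequality. - *Non-convex.* If $f(X^{(0)})-\inf f\le\Delta_0$, then $\mathbb E\|\nabla f(\bar X^{\rm out})\|^2\le\varepsilon$ for $$T\ge c\,\Delta_0\Bigl(\frac{L\sigma^2}{N\varepsilon^2}+\frac{L(\zeta+\sigma)}{\rho\delta\varepsilon^{3/2}}+\frac{L}{\rho\delta\varepsilon}\Bigr).$$ - *Convex.* If $\{f_i\}$ is $\mu$-convex with $\mu=0$ and $X^\star$ is a minimizer of $f$ with $\|X^{(0)}-X^\star\|\le R$, then $\mathbb E f(\bar X^{\rm out})-f(X^\star)\le\varepsilon$ for $$T\ge c\,R^2\Bigl(\frac{\sigma^2}{N\varepsilon^2}+\frac{\sqrt L(\zeta+\sigma)}{\rho\delta\varepsilon^{3/2}}+\frac{L}{\rho\delta\varepsilon}\Bigr).$$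 - *Strongly convex.* If $\{f_i\}$ is $\mu$-convex with $\mu>0$ and $X^\star$ is a minimizer of $f$ with $\|X^{(0)}-X^\star\|\le R$, then $\mathbb E f(\bar X^{\rm out})-f(X^\star)\le\varepsilon$ for $$T\ge c\Bigl(\frac{\sigma^2}{N\mu\varepsilon}+\frac{\sqrt L(\zeta+\sigma)}{\rho\delta\mu\sqrt\varepsilon}+\frac{L}{\rho\delta\mu}\Bigr)\log\Bigl(2+\frac{\mu R^2}{\varepsilon}\Bigr).$$ -/

import Mathlib

open MeasureTheory ProbabilityTheory

universe u v

noncomputable section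

/-- Model parameters: real `p × q` matrices. The norm and inner product of `EuclideanSpace` over the
set of entries are the Frobenius norm and the Frobenius inner product. -/
abbrev Params (p q : ℕ) : Type := EuclideanSpace ℝ (Fin p × Fin q)

/-- `rho` is the spectral gap of the symmetric matrix `W`: `rho = 1 - l` where `l` is the second
largest eigenvalue (with multiplicity) of `W ^ 2`. In particular there are at least two nodes. -/
def HasSpectralGap {N : ℕ} (W : Matrix (Fin N) (Fin N) ℝ) (rho : ℝ) : Prop :=
  ∃ (h : (W ^ 2).IsHermitian) (hN : 1 < Fintype.card (Fin N)),
    rho = 1 - h.eigenvalues₀ ⟨1, hN⟩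

/-- Mixing matrix on the network `G` (every node is also linked to itself): supported on the links,
symmetric, doubly stochastic, with positive spectral gap `rho`. -/
structure IsMixing {N : ℕ} (G : SimpleGraph (Fin N)) (W : Matrix (Fin N) (Fin N) ℝ)
    (rho : ℝ) : Prop where
  support : ∀ i j, W i j ≠ 0 → i = j ∨ G.Adj i j
  symm : W.IsSymm
  doubly_stochastic : W ∈ doublyStochastic ℝ (Fin N)
  gap : HasSpectralGap W rho
  gap_pos : 0 < rho

/-- The expected loss of one worker, `f_i(X) = E_{s ∼ D} F(X, s)`. -/
def localLoss {p q : ℕ} {Ξ : Type*} [MeasurableSpace Ξ] (F : Params p q → Ξ → ℝ) (D : Measure Ξ)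
    (X : Params p q) : ℝ := ∫ s, F X s ∂D

/-- The stochastic gradient `∇F(X, s)`, the gradient in `X` at the data point `s`. -/
def stochGrad {p q : ℕ} {Ξ : Type*} (F : Params p q → Ξ → ℝ) (X : Params p q) (s : Ξ) :
    Params p q := gradient (fun Z => F Z s) X

/-- The stochastic gradient oracle of one worker: losses that are differentiable in the parameters,
with gradients that are measurable, unbiased, and of variance at most `sigma ^ 2` everywhere. -/
structure IsOracle {p q : ℕ} {Ξ : Type*} [MeasurableSpace Ξ] (F : Params p q → Ξ → ℝ)
    (D : Measure Ξ) (sigma : ℝ) : Prop where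
  prob : IsProbabilityMeasure D
  integrable : ∀ X, Integrable (F X) D
  differentiable : ∀ s, Differentiable ℝ (fun X => F X s)
  measurable_grad : Measurable (fun z : Params p q × Ξ => stochGrad F z.1 z.2)
  square_integrable : ∀ X, MemLp (stochGrad F X) 2 D
  unbiased : ∀ X, ∫ s, stochGrad F X s ∂D = gradient (localLoss F D) X
  variance_le : ∀ X, ∫ s, ‖stochGrad F X s - gradient (localLoss F D) X‖ ^ 2 ∂D ≤ sigma ^ 2

/-- `g` is differentiable with `L`-Lipschitz gradient. -/
structure IsSmoothLoss {p q : ℕ} (g : Params p q → ℝ) (L : ℝ) : Prop where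
  differentiable : Differentiable ℝ g
  lipschitz_grad : ∀ X Y, ‖gradient g X - gradient g Y‖ ≤ L * ‖X - Y‖

/-- `Xs` is a global minimizer of `f`. -/
def IsMinimizer {p q : ℕ} (f : Params p q → ℝ) (Xs : Params p q) : Prop := ∀ Z, f Xs ≤ f Z

/-- `g` is `mu`-(star-)convex relative to the minimizers of `f`. -/
def IsMuConvex {p q : ℕ} (mu : ℝ) (f g : Params p q → ℝ) : Prop :=
  ∀ X Xs, IsMinimizer f Xs →
    inner ℝ (gradient g X) (Xs - X) ≤ -(g X - g Xs + mu / 2 * ‖X - Xs‖ ^ 2)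

/-- Everything a run of the algorithm consists of: `N` workers, parameters in `ℝ^{p × q}`, data
points in `Ξ`, randomness in `Ω`. -/
structure Run (N p q : ℕ) (Ξ Ω : Type*) [MeasurableSpace Ξ] [MeasurableSpace Ω] where
  /-- the underlying probability measure -/
  P : Measure Ω
  /-- the sample losses of the workers -/
  F : Fin N → Params p q → Ξ → ℝ
  /-- the data distributions of the workers -/
  D : Fin N → Measure Ξ
  /-- the communication network (self-links are left implicit) -/
  G : SimpleGraph (Fin N)
  /-- the mixing matrix -/
  W : Matrix (Fin N) (Fin N) ℝ
  /-- the common initial model -/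
  X0 : Params p q
  /-- `sample t i`: the data point that worker `i` draws in round `t` (rounds start at `0`) -/
  sample : ℕ → Fin N → Ω → Ξ
  /-- `comp t i j`: the compressor on the edge `(i, j)` in round `t` -/
  comp : ℕ → Fin N → Fin N → Ω → (Params p q →L[ℝ] Params p q)

namespace Run

variable {N p q : ℕ} {Ξ Ω : Type*} [MeasurableSpace Ξ] [MeasurableSpace Ω]

/-- The loss `f_i` of worker `i`. -/
def lossOf (r : Run N p q Ξ Ω) (i : Fin N) : Params p q → ℝ := localLoss (r.F i) (r.D i)

/-- The objective `f = (1 / N) ∑ f_i`. -/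
def loss (r : Run N p q Ξ Ω) (X : Params p q) : ℝ := (1 / (N : ℝ)) * ∑ i, r.lossOf i X

/-- The information in the samples of round `t`. -/
abbrev samplesOf (r : Run N p q Ξ Ω) (t : ℕ) : MeasurableSpace Ω :=
  ⨆ i, MeasurableSpace.comap (r.sample t i) inferInstance

/-- The information in the compressors of round `t`. -/
abbrev compsOf (r : Run N p q Ξ Ω) (t : ℕ) : MeasurableSpace Ω :=
  ⨆ i, ⨆ j, MeasurableSpace.comap (r.comp t i j) inferInstance

/-- The information in all the rounds before round `t`. -/
abbrev history (r : Run N p q Ξ Ω) (t : ℕ) : MeasurableSpace Ω :=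
  ⨆ s ∈ Finset.range t, (r.samplesOf s ⊔ r.compsOf s)

/-- In every round the workers draw data points from their distributions, independently of each
other and of the past. -/
structure FreshSamples (r : Run N p q Ξ Ω) : Prop where
  measurable : ∀ t i, Measurable (r.sample t i)
  law : ∀ t i, Measure.map (r.sample t i) r.P = r.D i
  indep_workers : ∀ t, iIndepFun (fun i => r.sample t i) r.P
  indep_past : ∀ t, Indep (r.samplesOf t) (r.history t) r.P

/-- In every round all compressors on edges are `delta`-approximate unbiased linear projections:
almost surely orthogonal projections for the Frobenius inner product, with `E[C(X)] = delta X`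
given all that was drawn before. The two ends of an edge share a compressor. The joint law of the
compressors on different edges is arbitrary. -/
structure CompressorsOK (r : Run N p q Ξ Ω) (delta : ℝ) : Prop where
  measurable : ∀ t i j, Measurable (r.comp t i j)
  shared : ∀ t i j, r.G.Adj i j → ∀ᵐ ω ∂r.P, r.comp t i j ω = r.comp t j i ω
  projection : ∀ t i j, r.G.Adj i j → ∀ᵐ ω ∂r.P, IsStarProjection (r.comp t i j ω)
  unbiased : ∀ t i j, r.G.Adj i j → ∀ X : Params p q,
    r.P[fun ω => r.comp t i j ω X | r.history t ⊔ r.samplesOf t] =ᵐ[r.P] fun _ => delta • X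

/-- The standing assumptions: smooth losses, bounded variance within and across the workers,
a mixing matrix with spectral gap `rho`, and `delta`-approximate compressors. -/
structure Assumptions (r : Run N p q Ξ Ω) (L sigma zeta rho delta : ℝ) : Prop where
  prob : IsProbabilityMeasure r.P
  smooth : ∀ i, IsSmoothLoss (r.lossOf i) L
  oracle : ∀ i, IsOracle (r.F i) (r.D i) sigma
  heterogeneity : ∀ X,
    (1 / (N : ℝ)) * ∑ i, ‖gradient (r.lossOf i) X - gradient r.loss X‖ ^ 2 ≤ zeta ^ 2
  mixing : IsMixing r.G r.W rho
  samples : r.FreshSamples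
  compressors : r.CompressorsOK delta

/-- The local step in round `t` from the models `X`:
`Y_i = X_i - eta_t ∇F_i(X_i, sample_{t,i})`. -/
def localStep (r : Run N p q Ξ Ω) (eta : ℕ → ℝ) (t : ℕ) (ω : Ω) (X : Fin N → Params p q)
    (i : Fin N) : Params p q :=
  X i - eta t • stochGrad (r.F i) (X i) (r.sample t i ω)

open Classical in
/-- The compressed consensus step in round `t` from the models `Y`:
`Y_i + ∑_{j ∈ N_i} W_ij (C_ij(Y_j) - C_ij(Y_i))`. The self-link would contribute zero. -/
def consensusStep (r : Run N p q Ξ Ω) (t : ℕ) (ω : Ω) (Y : Fin N → Params p q)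
    (i : Fin N) : Params p q :=
  Y i + ∑ j with r.G.Adj i j, r.W i j • (r.comp t i j ω (Y j) - r.comp t i j ω (Y i))

/-- The models of the workers after `t` rounds with stepsizes `eta`. -/
def iterate (r : Run N p q Ξ Ω) (eta : ℕ → ℝ) (ω : Ω) : ℕ → Fin N → Params p q
  | 0 => fun _ => r.X0
  | t + 1 => r.consensusStep t ω (r.localStep eta t ω (r.iterate eta ω t))

/-- The average over the workers of the output models `X_i^out = X_i^{(τ)}`, as a function of the
randomness `ω` of the run and of the output time `τ`. -/
def output (r : Run N p q Ξ Ω) (eta : ℕ → ℝ) (z : Ω × ℕ) : Params p q :=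
  (1 / (N : ℝ)) • ∑ i, r.iterate eta z.1 z.2 i

/-- Expected value of `phi` at the averaged output after `T` rounds is at most `eps`: the output
time is drawn from `{0, …, T}`, independently of the run, with probabilities proportional to
`alpha`. The expectation is required to exist. -/
def OutputAccurate (r : Run N p q Ξ Ω) (eta alpha : ℕ → ℝ) (T : ℕ) (phi : Params p q → ℝ)
    (eps : ℝ) : Prop :=
  let total : ℝ := ∑ t ∈ Finset.range (T + 1), alpha t
  let timeLaw : Measure ℕ :=
    ∑ t ∈ Finset.range (T + 1), ENNReal.ofReal (alpha t / total) • Measure.dirac t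
  0 < total ∧
    Integrable (fun z => phi (r.output eta z)) (r.P.prod timeLaw) ∧
    ∫ z, phi (r.output eta z) ∂(r.P.prod timeLaw) ≤ eps

end Run

end

/-! The compressor of an edge is linear and shared, so the two messages on the edge are opposite and
gossip leaves the mean of the models unchanged, almost surely. The mean therefore performs SGD with
the averaged local gradients and a noise of variance at most σ²/N
(`integral_norm_average_noise_sq_le`). The usual one-step inequalities (`loss_step_le`,
`dist_step_le`) hold for it up to an error proportional to the consensus distance, the mean squared
deviation of the workers from their mean.

The crux is that the consensus distance contracts at a rate of order ρδ although compressors on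
different edges may be dependent. Let V be the deviations, d_ij the compressed difference on a link,
and m_i = ∑_j W_ij d_ij. Projections satisfy ‖d_ij‖² = ⟨V_j - V_i, d_ij⟩. For the plain squared norm
this gives 2⟨V, m⟩ + ‖m‖² ≤ 0: no growth, but no contraction either. The proof uses the energy E(V)
= ⟨V, (3 + W)V⟩ instead (`gossipEnergy`), which lies between 2‖V‖² and 4‖V‖². For antisymmetric d
one has E(m) ≤ 2 ∑ W_ij ‖d_ij‖² (`gossipEnergy_divergence_le`), and by the projection identity the
right side is linear in d. So the growth of E is bounded by a linear function of d
(`gossipEnergy_add_divergence_le`). Its expectation involves only the conditional mean δ(V_j - V_i)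
of each d_ij; joint laws do not enter. Inserting the means gives δ times the quadratic form of 2(3 +
W)(W - 1) + 4(1 - W) = 2(W² - 1), exactly the matrix with gap ρ, hence the factor 1 - ρδ/2
(`gossipEnergy_mean_step_le`).

With a constant stepsize e at most ρδ/(32L), this contraction balances the spread created by the
local steps, and the consensus distance stays of order (e(ζ + σ)/(ρδ))² (`integral_consensus_le`).
Take e = 1/(32 S), where S is a sum of three terms, one for the noise, one for the consensus error,
one for stability. Then the persistent errors cost at most ε/2. Telescoping, with uniform weights or
with weights (1 + eμ)^(t+1), brings the contribution of the initial error below ε/2 after the stated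
number of rounds. The case L = 0 and the zero-dimensional parameter space are trivial and treated
apart. -/

noncomputable section

/-! ### Doubly stochastic matrices -/

section Mixing

open Matrix

/-- In an eigenbasis of W², every eigenvalue but the top one is at most 1 - ρ < 1. The vector of
ones has eigenvalue 1, so it lies on the top eigenline, and a vector with zero sum has no component
there. -/
lemma HasSpectralGap.sum_sq_mulVec_le {N : ℕ} {W : Matrix (Fin N) (Fin N) ℝ} {rho : ℝ}
    (hgap : HasSpectralGap W rho) (hrho : 0 < rho) (hsymm : W.IsSymm)
    (hstoch : W ∈ doublyStochastic ℝ (Fin N)) {y : Fin N → ℝ} (hy : ∑ i, y i = 0) :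
    ∑ i, (∑ j, W i j * y j) ^ 2 ≤ (1 - rho) * ∑ i, y i ^ 2 := by
  obtain ⟨h, hN, hr⟩ := hgap
  set A := W ^ 2 with hA
  have hAT : Aᵀ = A := by rw [hA, Matrix.transpose_pow, hsymm.eq]
  set c : Fin N → (Fin N → ℝ) → ℝ := fun k z => ⇑(h.eigenvectorBasis k) ⬝ᵥ z with hc
  have parseval : ∀ x z : Fin N → ℝ, x ⬝ᵥ z = ∑ k, c k x * c k z := by
    intro x z
    have := h.eigenvectorBasis.sum_inner_mul_inner (WithLp.toLp 2 x) (WithLp.toLp 2 z)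
    simp only [EuclideanSpace.inner_eq_star_dotProduct, star_trivial] at this
    rw [dotProduct_comm x z, ← this]
    refine Finset.sum_congr rfl fun k _ => ?_
    simp only [hc]
    rw [dotProduct_comm z]
  have hcA : ∀ k z, c k (A *ᵥ z) = h.eigenvalues k * c k z := by
    intro k z
    simp only [hc]
    rw [Matrix.dotProduct_mulVec, ← Matrix.mulVec_transpose, hAT, h.mulVec_eigenvectorBasis,
      smul_dotProduct, smul_eq_mul]
  have hW1 : W *ᵥ 1 = 1 := (mem_doublyStochastic.1 hstoch).2.1
  have hA1 : A *ᵥ 1 = 1 := by rw [hA, sq, ← Matrix.mulVec_mulVec, hW1, hW1]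
  set e := (Fintype.equivOfCardEq (Fintype.card_fin (Fintype.card (Fin N))) :
    Fin (Fintype.card (Fin N)) ≃ Fin N) with he
  have heig : ∀ k, h.eigenvalues k = h.eigenvalues₀ (e.symm k) := fun k => rfl
  set k0 : Fin N := e ⟨0, by omega⟩ with hk0
  have hle : ∀ k, k ≠ k0 → h.eigenvalues k ≤ 1 - rho := by
    intro k hk
    rw [heig, hr, sub_sub_cancel]
    apply h.eigenvalues₀_antitone
    rw [Fin.le_def]
    by_contra hlt
    apply hk
    have : e.symm k = ⟨0, by omega⟩ := by
      ext
      simp only [not_le] at hlt ⊢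
      omega
    rw [hk0, ← this, e.apply_symm_apply]
  have hone : ∀ k, k ≠ k0 → c k 1 = 0 := by
    intro k hk
    have h1 := hcA k 1
    rw [hA1] at h1
    have h2 := hle k hk
    have : (1 - h.eigenvalues k) * c k 1 = 0 := by linarith
    rcases mul_eq_zero.1 this with h3 | h3
    · linarith
    · exact h3
  have hy1 : y ⬝ᵥ (1 : Fin N → ℝ) = 0 := by simp [dotProduct, hy]
  have hsum : ∀ f : Fin N → ℝ, (∀ k, k ≠ k0 → f k = 0) → ∑ k, f k = f k0 := fun f hf =>
    Finset.sum_eq_single k0 (fun b _ hb => hf b hb) (by simp)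
  have hy0 : c k0 y = 0 := by
    have h1 := parseval y 1
    rw [hy1, hsum _ (fun k hk => by rw [hone k hk, mul_zero])] at h1
    have h2 := parseval 1 1
    rw [hsum _ (fun k hk => by rw [hone k hk, mul_zero])] at h2
    rcases mul_eq_zero.1 h1.symm with h3 | h3
    · exact h3
    · rw [h3, mul_zero] at h2
      have : (1 : Fin N → ℝ) ⬝ᵥ 1 = N := by simp [dotProduct]
      rw [this] at h2
      have hN0 : N = 0 := by exact_mod_cast h2
      simp [hN0] at hN
  have e1 : ∑ i, (∑ j, W i j * y j) ^ 2 = y ⬝ᵥ (A *ᵥ y) := by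
    have : ∑ i, (∑ j, W i j * y j) ^ 2 = (W *ᵥ y) ⬝ᵥ (W *ᵥ y) := by
      simp [dotProduct, Matrix.mulVec, sq]
    rw [this, Matrix.dotProduct_mulVec, ← Matrix.mulVec_transpose, hsymm.eq, Matrix.mulVec_mulVec,
      ← sq, dotProduct_comm]
  have e2 : ∑ i, y i ^ 2 = y ⬝ᵥ y := by simp [dotProduct, sq]
  rw [e1, e2, parseval, parseval y y, Finset.mul_sum]
  refine Finset.sum_le_sum fun k _ => ?_
  rw [hcA]
  by_cases hk : k = k0
  · rw [hk, hy0]; simp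
  · have := hle k hk
    nlinarith [mul_self_nonneg (c k y)]

variable {N : ℕ} {W : Matrix (Fin N) (Fin N) ℝ}

lemma doublyStochastic_sum_left (hW : W ∈ doublyStochastic ℝ (Fin N)) (a : Fin N → ℝ) :
    ∑ i, ∑ j, W i j * a i = ∑ i, a i := by
  refine Finset.sum_congr rfl fun i _ => ?_
  rw [← Finset.sum_mul, sum_row_of_mem_doublyStochastic hW, one_mul]

lemma doublyStochastic_sum_right (hW : W ∈ doublyStochastic ℝ (Fin N)) (a : Fin N → ℝ) :
    ∑ i, ∑ j, W i j * a j = ∑ i, a i := by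
  rw [Finset.sum_comm]
  refine Finset.sum_congr rfl fun i _ => ?_
  rw [← Finset.sum_mul, sum_col_of_mem_doublyStochastic hW, one_mul]

lemma IsSymm.sum_swap {M : Type*} [AddCommGroup M] [Module ℝ M] (hs : W.IsSymm)
    (a : Fin N → Fin N → M) :
    ∑ i, ∑ j, W i j • a i j = ∑ i, ∑ j, W i j • a j i := by
  rw [Finset.sum_comm]
  refine Finset.sum_congr rfl fun i _ => Finset.sum_congr rfl fun j _ => ?_
  rw [hs.apply]

/-! ### The energy 3 + W and its contraction under compressed gossip -/

variable {E : Type*} [NormedAddCommGroup E]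

/-- The quadratic form of `3 + W` on fields of vectors on the nodes, written as a sum of squares
(for doubly stochastic `W`). -/
def gossipEnergy (W : Matrix (Fin N) (Fin N) ℝ) (V : Fin N → E) : ℝ :=
  2 * ∑ i, ‖V i‖ ^ 2 + 1 / 2 * ∑ i, ∑ j, W i j * ‖V i + V j‖ ^ 2

lemma gossipEnergy_lower (hW : W ∈ doublyStochastic ℝ (Fin N)) (V : Fin N → E) :
    2 * ∑ i, ‖V i‖ ^ 2 ≤ gossipEnergy W V := by
  have : 0 ≤ ∑ i, ∑ j, W i j * ‖V i + V j‖ ^ 2 :=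
    Finset.sum_nonneg fun i _ => Finset.sum_nonneg fun j _ =>
      mul_nonneg (nonneg_of_mem_doublyStochastic hW) (sq_nonneg _)
  unfold gossipEnergy
  linarith

lemma norm_add_sq_le_two_mul (x y : E) : ‖x + y‖ ^ 2 ≤ 2 * ‖x‖ ^ 2 + 2 * ‖y‖ ^ 2 := by
  nlinarith [norm_add_le x y, norm_nonneg (x + y), norm_nonneg x, norm_nonneg y,
    sq_nonneg (‖x‖ - ‖y‖)]

lemma gossipEnergy_upper (hW : W ∈ doublyStochastic ℝ (Fin N)) (V : Fin N → E) :
    gossipEnergy W V ≤ 4 * ∑ i, ‖V i‖ ^ 2 := by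
  have : ∑ i, ∑ j, W i j * ‖V i + V j‖ ^ 2
      ≤ ∑ i, ∑ j, (W i j * (2 * ‖V i‖ ^ 2) + W i j * (2 * ‖V j‖ ^ 2)) :=
    Finset.sum_le_sum fun i _ => Finset.sum_le_sum fun j _ => by
      rw [← mul_add]
      exact mul_le_mul_of_nonneg_left (norm_add_sq_le_two_mul _ _)
        (nonneg_of_mem_doublyStochastic hW)
  simp only [Finset.sum_add_distrib] at this
  rw [doublyStochastic_sum_left hW (fun i => 2 * ‖V i‖ ^ 2),
    doublyStochastic_sum_right hW (fun i => 2 * ‖V i‖ ^ 2), ← Finset.mul_sum] at this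
  unfold gossipEnergy
  linarith

variable [InnerProductSpace ℝ E]

lemma norm_sub_smul_sq_le {th : ℝ} (hth : 0 < th) (eta : ℝ) (x y : E) :
    ‖x - eta • y‖ ^ 2 ≤ (1 + th) * ‖x‖ ^ 2 + (1 + 1 / th) * eta ^ 2 * ‖y‖ ^ 2 := by
  have h1 : ‖x - eta • y‖ ≤ ‖x‖ + ‖eta • y‖ := norm_sub_le _ _
  have h2 : ‖eta • y‖ ^ 2 = eta ^ 2 * ‖y‖ ^ 2 := by rw [norm_smul, mul_pow, Real.norm_eq_abs, sq_abs]
  rw [mul_assoc, ← h2]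
  set a := ‖x‖
  set b := ‖eta • y‖
  have h3 : 0 ≤ (th * a - b) ^ 2 / th := by positivity
  have h4 : (th * a - b) ^ 2 / th = th * a ^ 2 - 2 * a * b + 1 / th * b ^ 2 := by field_simp; ring
  nlinarith [norm_nonneg (x - eta • y)]

/-- Young's inequality applies to each square separately; this is the benefit of writing the form as
a sum of squares with nonnegative weights. -/
lemma gossipEnergy_sub_smul_le (hW : W ∈ doublyStochastic ℝ (Fin N)) {th : ℝ} (hth : 0 < th)
    (eta : ℝ) (V M : Fin N → E) :
    gossipEnergy W (fun i => V i - eta • M i)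
      ≤ (1 + th) * gossipEnergy W V + (1 + 1 / th) * eta ^ 2 * gossipEnergy W M := by
  have h1 : ∑ i, ‖V i - eta • M i‖ ^ 2
      ≤ (1 + th) * ∑ i, ‖V i‖ ^ 2 + (1 + 1 / th) * eta ^ 2 * ∑ i, ‖M i‖ ^ 2 := by
    rw [Finset.mul_sum, Finset.mul_sum, ← Finset.sum_add_distrib]
    exact Finset.sum_le_sum fun i _ => norm_sub_smul_sq_le hth eta _ _
  have h2 : ∑ i, ∑ j, W i j * ‖V i - eta • M i + (V j - eta • M j)‖ ^ 2
      ≤ (1 + th) * ∑ i, ∑ j, W i j * ‖V i + V j‖ ^ 2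
        + (1 + 1 / th) * eta ^ 2 * ∑ i, ∑ j, W i j * ‖M i + M j‖ ^ 2 := by
    simp only [Finset.mul_sum, ← Finset.sum_add_distrib]
    refine Finset.sum_le_sum fun i _ => Finset.sum_le_sum fun j _ => ?_
    have e : V i - eta • M i + (V j - eta • M j) = (V i + V j) - eta • (M i + M j) := by
      rw [smul_add]; abel
    rw [e]
    have := mul_le_mul_of_nonneg_left (norm_sub_smul_sq_le hth eta (V i + V j) (M i + M j))
      (nonneg_of_mem_doublyStochastic hW (i := i) (j := j))
    linarith
  unfold gossipEnergy
  linarith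

/-- Expanding the squares on the links, the unit row and column sums each contribute half of ∑ ‖V
i‖², which turns the coefficient 2 into 3. -/
lemma gossipEnergy_eq_inner (hW : W ∈ doublyStochastic ℝ (Fin N)) (V : Fin N → E) :
    gossipEnergy W V = 3 * ∑ i, ‖V i‖ ^ 2 + ∑ i, ∑ j, W i j * inner ℝ (V i) (V j) := by
  have h1 := doublyStochastic_sum_left hW (fun i => ‖V i‖ ^ 2)
  have h2 := doublyStochastic_sum_right hW (fun i => ‖V i‖ ^ 2)
  have : ∑ i, ∑ j, W i j * ‖V i + V j‖ ^ 2 = ∑ i, ∑ j, W i j * ‖V i‖ ^ 2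
      + 2 * ∑ i, ∑ j, W i j * inner ℝ (V i) (V j) + ∑ i, ∑ j, W i j * ‖V j‖ ^ 2 := by
    simp only [Finset.mul_sum, ← Finset.sum_add_distrib]
    refine Finset.sum_congr rfl fun i _ => Finset.sum_congr rfl fun j _ => ?_
    rw [norm_add_sq_real]; ring
  unfold gossipEnergy
  rw [this, h1, h2]
  ring

/-- The energy of the divergence of an antisymmetric flow is controlled by the energy of the
flow. -/
lemma gossipEnergy_divergence_le (hs : W.IsSymm) (hW : W ∈ doublyStochastic ℝ (Fin N))
    (d : Fin N → Fin N → E) (hd : ∀ i j, W i j ≠ 0 → d j i = -d i j) :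
    gossipEnergy W (fun i => ∑ j, W i j • d i j) ≤ 2 * ∑ i, ∑ j, W i j * ‖d i j‖ ^ 2 := by
  set m : Fin N → E := fun i => ∑ j, W i j • d i j with hm
  have hcross : ∑ i, ∑ j, W i j * inner ℝ (d i j) (m i) = ∑ i, ‖m i‖ ^ 2 := by
    refine Finset.sum_congr rfl fun i _ => ?_
    rw [← real_inner_self_eq_norm_sq (m i)]
    conv_rhs => rw [hm]
    simp only [sum_inner, inner_smul_left]
    rfl
  have hcross' : ∑ i, ∑ j, W i j * inner ℝ (d i j) (m j) = -∑ i, ‖m i‖ ^ 2 := by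
    have := IsSymm.sum_swap hs (fun i j => (inner ℝ (d i j) (m j) : ℝ))
    simp only [smul_eq_mul] at this
    rw [this, ← hcross, ← Finset.sum_neg_distrib]
    refine Finset.sum_congr rfl fun i _ => ?_
    rw [← Finset.sum_neg_distrib]
    refine Finset.sum_congr rfl fun j _ => ?_
    by_cases h0 : W i j = 0
    · simp [h0]
    · rw [hd i j h0, inner_neg_left]; ring
  have h1 := doublyStochastic_sum_left hW (fun i => ‖m i‖ ^ 2)
  have h2 := doublyStochastic_sum_right hW (fun i => ‖m i‖ ^ 2)
  -- Completing the square. The cross terms of `d i j` with `m i` and with `m j` sum to ∑ ‖m i‖² and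
  -- its negative by antisymmetry, and `‖m i - m j‖²` is traded for `‖m i + m j‖²` by the
  -- parallelogram law; what remains is half of the claim.
  have hnn : 0 ≤ ∑ i, ∑ j, W i j * ‖d i j - (1 / 2 : ℝ) • (m i - m j)‖ ^ 2 :=
    Finset.sum_nonneg fun i _ => Finset.sum_nonneg fun j _ =>
      mul_nonneg (nonneg_of_mem_doublyStochastic hW) (sq_nonneg _)
  have hexp : ∑ i, ∑ j, W i j * ‖d i j - (1 / 2 : ℝ) • (m i - m j)‖ ^ 2
      = ∑ i, ∑ j, W i j * ‖d i j‖ ^ 2 - ∑ i, ∑ j, W i j * inner ℝ (d i j) (m i)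
        + ∑ i, ∑ j, W i j * inner ℝ (d i j) (m j)
        + 1 / 2 * ∑ i, ∑ j, W i j * ‖m i‖ ^ 2 + 1 / 2 * ∑ i, ∑ j, W i j * ‖m j‖ ^ 2
        - 1 / 4 * ∑ i, ∑ j, W i j * ‖m i + m j‖ ^ 2 := by
    simp only [Finset.mul_sum, ← Finset.sum_add_distrib, ← Finset.sum_sub_distrib]
    refine Finset.sum_congr rfl fun i _ => Finset.sum_congr rfl fun j _ => ?_
    rw [norm_sub_sq_real, norm_add_sq_real, norm_smul, mul_pow, norm_sub_sq_real, inner_smul_right,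
      inner_sub_right, Real.norm_eq_abs, sq_abs]
    ring
  rw [hexp, hcross, hcross', h1, h2] at hnn
  unfold gossipEnergy
  linarith

/-- The vector that is paired with the compressed difference `d i j` in the expansion of the energy
after a consensus step. -/
def gossipDual (W : Matrix (Fin N) (Fin N) ℝ) (V : Fin N → E) (i j : Fin N) : E :=
  (2 : ℝ) • ((3 : ℝ) • V i + ∑ k, W i k • V k) + (2 : ℝ) • (V j - V i)

/-- The quadratic term, the energy of the divergence, is at most 2 ∑ W_ij ‖d_ij‖², which the
projection identity turns into a linear term. The resulting bound is affine in `d`, so that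
expectations can be taken link by link. -/
lemma gossipEnergy_add_divergence_le (hs : W.IsSymm) (hW : W ∈ doublyStochastic ℝ (Fin N))
    (V : Fin N → E) (d : Fin N → Fin N → E) (hd : ∀ i j, W i j ≠ 0 → d j i = -d i j)
    (hproj : ∀ i j, W i j ≠ 0 → ‖d i j‖ ^ 2 = inner ℝ (V j - V i) (d i j)) :
    gossipEnergy W (fun i => V i + ∑ j, W i j • d i j)
      ≤ gossipEnergy W V + ∑ i, ∑ j, W i j * inner ℝ (gossipDual W V i j) (d i j) := by
  set m : Fin N → E := fun i => ∑ j, W i j • d i j with hm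
  have hdiv := gossipEnergy_divergence_le hs hW d hd
  have hS : ∑ i, ∑ j, W i j * ‖d i j‖ ^ 2 = ∑ i, ∑ j, W i j * inner ℝ (V j - V i) (d i j) := by
    refine Finset.sum_congr rfl fun i _ => Finset.sum_congr rfl fun j _ => ?_
    by_cases h0 : W i j = 0
    · simp [h0]
    · rw [hproj i j h0]
  have hcross : ∀ U : Fin N → E, ∑ i, ∑ j, W i j * inner ℝ (U i) (d i j)
      = ∑ i, inner ℝ (U i) (m i) := by
    intro U
    refine Finset.sum_congr rfl fun i _ => ?_
    rw [hm]
    simp only [inner_sum, inner_smul_right]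
  have hdual : ∑ i, ∑ j, W i j * inner ℝ (gossipDual W V i j) (d i j)
      = 2 * ∑ i, ∑ j, W i j * inner ℝ ((3 : ℝ) • V i + ∑ k, W i k • V k) (d i j)
        + 2 * ∑ i, ∑ j, W i j * inner ℝ (V j - V i) (d i j) := by
    simp only [Finset.mul_sum, ← Finset.sum_add_distrib]
    refine Finset.sum_congr rfl fun i _ => Finset.sum_congr rfl fun j _ => ?_
    rw [gossipDual, inner_add_left, real_inner_smul_left, real_inner_smul_left]
    ring
  have hB : ∑ i, inner ℝ ((3 : ℝ) • V i + ∑ k, W i k • V k) (m i)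
      = 3 * ∑ i, inner ℝ (V i) (m i) + ∑ i, ∑ j, W i j * inner ℝ (V j) (m i) := by
    simp only [Finset.mul_sum, ← Finset.sum_add_distrib]
    refine Finset.sum_congr rfl fun i _ => ?_
    rw [inner_add_left, real_inner_smul_left, sum_inner]
    simp only [real_inner_smul_left]
  have hB' := IsSymm.sum_swap hs (fun i j => (inner ℝ (V j) (m i) : ℝ))
  simp only [smul_eq_mul] at hB'
  have hexp : gossipEnergy W (fun i => V i + m i)
      = gossipEnergy W V + (6 * ∑ i, inner ℝ (V i) (m i)
        + ∑ i, ∑ j, W i j * inner ℝ (V j) (m i) + ∑ i, ∑ j, W i j * inner ℝ (V i) (m j))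
        + gossipEnergy W m := by
    rw [gossipEnergy_eq_inner hW, gossipEnergy_eq_inner hW, gossipEnergy_eq_inner hW]
    have e1 : ∑ i, ‖V i + m i‖ ^ 2
        = ∑ i, ‖V i‖ ^ 2 + 2 * ∑ i, inner ℝ (V i) (m i) + ∑ i, ‖m i‖ ^ 2 := by
      simp only [Finset.mul_sum, ← Finset.sum_add_distrib]
      exact Finset.sum_congr rfl fun i _ => norm_add_sq_real _ _
    have e2 : ∑ i, ∑ j, W i j * inner ℝ (V i + m i) (V j + m j)
        = ∑ i, ∑ j, W i j * inner ℝ (V i) (V j) + ∑ i, ∑ j, W i j * inner ℝ (V j) (m i)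
          + ∑ i, ∑ j, W i j * inner ℝ (V i) (m j) + ∑ i, ∑ j, W i j * inner ℝ (m i) (m j) := by
      simp only [← Finset.sum_add_distrib]
      refine Finset.sum_congr rfl fun i _ => Finset.sum_congr rfl fun j _ => ?_
      rw [inner_add_left, inner_add_right, inner_add_right, real_inner_comm (V j) (m i)]
      ring
    rw [e1, e2]; ring
  change gossipEnergy W (fun i => V i + m i) ≤ _
  rw [hexp, hdual, hcross, hB, ← hS, hB']
  rw [← hm] at hdiv
  rw [← hB']
  linarith

lemma IsMixing.sum_norm_sq_le {p q : ℕ} {G : SimpleGraph (Fin N)} {rho : ℝ}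
    (hmix : IsMixing G W rho) {V : Fin N → Params p q} (hV : ∑ i, V i = 0) :
    ∑ i, ‖∑ j, W i j • V j‖ ^ 2 ≤ (1 - rho) * ∑ i, ‖V i‖ ^ 2 := by
  simp only [EuclideanSpace.real_norm_sq_eq]
  rw [Finset.sum_comm, Finset.sum_comm (f := fun i k => (V i).ofLp k ^ 2), Finset.mul_sum]
  refine Finset.sum_le_sum fun k _ => ?_
  have := hmix.gap.sum_sq_mulVec_le hmix.gap_pos hmix.symm hmix.doubly_stochastic
    (y := fun i => V i k) (by
      have := congrArg (fun v : Params p q => v k) hV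
      simpa using this)
  simpa using this

/-- This is the affine bound with each compressed difference replaced by its mean. The terms of
first order in W cancel, which is the reason for the constant 3 in the energy, and only W² - 1 is
left. -/
lemma gossipEnergy_mean_step_le {p q : ℕ} {G : SimpleGraph (Fin N)} {rho delta : ℝ}
    (hmix : IsMixing G W rho) (hdelta : 0 ≤ delta) {V : Fin N → Params p q} (hV : ∑ i, V i = 0) :
    gossipEnergy W V + delta * ∑ i, ∑ j, W i j * inner ℝ (gossipDual W V i j) (V j - V i)
      ≤ (1 - rho * delta / 2) * gossipEnergy W V := by
  have hW := hmix.doubly_stochastic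
  have hgap := hmix.sum_norm_sq_le hV
  have hup := gossipEnergy_upper hW V
  have h1 := doublyStochastic_sum_left hW (fun i => ‖V i‖ ^ 2)
  have h2 := doublyStochastic_sum_right hW (fun i => ‖V i‖ ^ 2)
  set u : Fin N → Params p q := fun i => ∑ j, W i j • V j with hu
  have hcross : ∀ U : Fin N → Params p q, ∑ i, ∑ j, W i j * inner ℝ (U i) (V j)
      = ∑ i, inner ℝ (U i) (u i) := by
    intro U
    refine Finset.sum_congr rfl fun i _ => ?_
    rw [hu]
    simp only [inner_sum, inner_smul_right]
  have hc1 := hcross V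
  have hc2 := hcross u
  have hc3 := doublyStochastic_sum_left hW (fun i => inner ℝ (u i) (V i))
  have hsum : ∑ i, ∑ j, W i j * inner ℝ (gossipDual W V i j) (V j - V i)
      = 2 * ∑ i, ‖u i‖ ^ 2 - 2 * ∑ i, ‖V i‖ ^ 2 := by
    have : ∑ i, ∑ j, W i j * inner ℝ (gossipDual W V i j) (V j - V i)
        = 2 * ∑ i, ∑ j, W i j * inner ℝ (V i) (V j) + 2 * ∑ i, ∑ j, W i j * inner ℝ (u i) (V j)
          - 2 * ∑ i, ∑ j, W i j * inner ℝ (u i) (V i)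
          + 2 * ∑ i, ∑ j, W i j * ‖V j‖ ^ 2 - 4 * ∑ i, ∑ j, W i j * ‖V i‖ ^ 2 := by
      simp only [Finset.mul_sum, ← Finset.sum_add_distrib, ← Finset.sum_sub_distrib]
      refine Finset.sum_congr rfl fun i _ => Finset.sum_congr rfl fun j _ => ?_
      have hui : ∑ k, W i k • V k = u i := rfl
      rw [gossipDual, hui]
      simp only [inner_add_left, inner_sub_right, inner_sub_left, real_inner_smul_left,
        real_inner_self_eq_norm_sq, real_inner_comm (V i) (V j)]
      ring
    rw [this, hc1, hc2, hc3, h1, h2]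
    have e3 : ∑ i, inner ℝ (u i) (V i) = ∑ i, (inner ℝ (V i) (u i) : ℝ) :=
      Finset.sum_congr rfl fun i _ => real_inner_comm _ _
    simp only [real_inner_self_eq_norm_sq]
    rw [e3]; ring
  rw [hsum]
  have hrd : 0 ≤ rho * delta := mul_nonneg hmix.gap_pos.le hdelta
  -- The gap gives a decrease of 2ρδ ∑ ‖V i‖², and the upper bound of the energy by 4 ∑ ‖V i‖² turns
  -- it into ρδ/2 times the energy.
  have h5 := mul_le_mul_of_nonneg_left hgap hdelta
  have h6 := mul_le_mul_of_nonneg_left hup hrd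
  nlinarith

end Mixing

/-! ### Smooth losses -/

section Smooth

variable {p q : ℕ} {g : Params p q → ℝ} {L : ℝ}

lemma IsSmoothLoss.hasDerivAt_line (hg : IsSmoothLoss g L) (x v : Params p q) (s : ℝ) :
    HasDerivAt (fun s : ℝ => g (x + s • v)) (inner ℝ (gradient g (x + s • v)) v) s := by
  have h1 := (hg.differentiable (x + s • v)).hasFDerivAt
  have h2 : HasDerivAt (fun s : ℝ => x + s • v) v s := by
    simpa using ((hasDerivAt_id s).smul_const v).const_add x
  have h3 : (inner ℝ (gradient g (x + s • v)) v : ℝ) = fderiv ℝ g (x + s • v) v := by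
    simp [gradient]
  rw [h3]
  exact h1.comp_hasDerivAt s h2

lemma IsSmoothLoss.neg (hg : IsSmoothLoss g L) : IsSmoothLoss (fun x => -g x) L := by
  have hgrad : ∀ x, gradient (fun x => -g x) x = -gradient g x := fun x => by
    simp only [gradient, fderiv_fun_neg, map_neg]
  refine ⟨hg.differentiable.neg, fun X Y => ?_⟩
  rw [hgrad, hgrad, neg_sub_neg, norm_sub_rev]
  exact hg.lipschitz_grad X Y

lemma IsSmoothLoss.le_quadratic (hg : IsSmoothLoss g L) (x y : Params p q) :
    g y ≤ g x + inner ℝ (gradient g x) (y - x) + L / 2 * ‖y - x‖ ^ 2 := by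
  set v := y - x with hv
  -- `φ` is the loss along the segment minus its quadratic majorant, up to a constant; the Lipschitz
  -- gradient makes its derivative nonpositive.
  set φ : ℝ → ℝ := fun s => g (x + s • v) - s * inner ℝ (gradient g x) v - L / 2 * s ^ 2 * ‖v‖ ^ 2
    with hφ
  have hder : ∀ s, HasDerivAt φ (inner ℝ (gradient g (x + s • v)) v
      - inner ℝ (gradient g x) v - L * s * ‖v‖ ^ 2) s := by
    intro s
    have h2 : HasDerivAt (fun s : ℝ => s * inner ℝ (gradient g x) v) (inner ℝ (gradient g x) v) s := by
      simpa using (hasDerivAt_id s).mul_const (inner ℝ (gradient g x) v : ℝ)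
    have h3 : HasDerivAt (fun s : ℝ => L / 2 * s ^ 2 * ‖v‖ ^ 2) (L * s * ‖v‖ ^ 2) s := by
      have := (((hasDerivAt_id s).pow 2).const_mul (L / 2)).mul_const (‖v‖ ^ 2)
      refine this.congr_deriv ?_
      simp only [id, Nat.cast_ofNat, Nat.add_one_sub_one, pow_one]
      ring
    exact ((hg.hasDerivAt_line x v s).sub h2).sub h3
  have hanti : AntitoneOn φ (Set.Icc 0 1) := by
    refine antitoneOn_of_deriv_nonpos (convex_Icc 0 1)
      (fun s _ => (hder s).continuousAt.continuousWithinAt)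
      (fun s _ => (hder s).differentiableAt.differentiableWithinAt) fun s hs => ?_
    rw [interior_Icc] at hs
    rw [(hder s).deriv, ← inner_sub_left]
    have h1 := real_inner_le_norm (gradient g (x + s • v) - gradient g x) v
    have h2 := hg.lipschitz_grad (x + s • v) x
    rw [add_sub_cancel_left, norm_smul, Real.norm_eq_abs, abs_of_pos hs.1] at h2
    have h3 := mul_le_mul_of_nonneg_right h2 (norm_nonneg v)
    nlinarith
  have := hanti (Set.left_mem_Icc.2 zero_le_one) (Set.right_mem_Icc.2 zero_le_one) zero_le_one
  simp only [hφ, one_smul, zero_smul, hv, add_sub_cancel, add_zero] at this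
  rw [hv]
  linarith

lemma IsSmoothLoss.quadratic_le (hg : IsSmoothLoss g L) (x y : Params p q) :
    g x + inner ℝ (gradient g x) (y - x) - L / 2 * ‖y - x‖ ^ 2 ≤ g y := by
  have := hg.neg.le_quadratic x y
  have hgrad : gradient (fun x => -g x) x = -gradient g x := by
    simp only [gradient, fderiv_fun_neg, map_neg]
  rw [hgrad, inner_neg_left] at this
  linarith

lemma IsSmoothLoss.continuous_gradient (hg : IsSmoothLoss g L) : Continuous (gradient g) := by
  have : LipschitzWith (Real.toNNReal L) (gradient g) := by
    refine LipschitzWith.of_dist_le_mul fun x y => ?_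
    rw [dist_eq_norm, dist_eq_norm]
    exact (hg.lipschitz_grad x y).trans
      (mul_le_mul_of_nonneg_right (Real.le_coe_toNNReal L) (norm_nonneg _))
  exact this.continuous

/-- The gradient of a smooth function that is bounded below is bounded by the optimality gap. -/
lemma IsSmoothLoss.norm_gradient_sq_le (hg : IsSmoothLoss g L) (hL : 0 < L) {m : ℝ}
    (hm : ∀ z, m ≤ g z) (x : Params p q) : ‖gradient g x‖ ^ 2 ≤ 2 * L * (g x - m) := by
  -- A gradient step of length 1/L decreases `g` by at least ‖∇g(x)‖²/(2L), yet cannot pass below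
  -- `m`.
  have h := (hm _).trans (hg.le_quadratic x (x - (1 / L) • gradient g x))
  rw [sub_sub_cancel_left, inner_neg_right, inner_smul_right, real_inner_self_eq_norm_sq, norm_neg,
    norm_smul, mul_pow, Real.norm_eq_abs, sq_abs] at h
  have e : g x + -(1 / L * ‖gradient g x‖ ^ 2) + L / 2 * ((1 / L) ^ 2 * ‖gradient g x‖ ^ 2)
      = g x - ‖gradient g x‖ ^ 2 / (2 * L) := by field_simp; ring
  rw [e] at h
  have : ‖gradient g x‖ ^ 2 / (2 * L) ≤ g x - m := by linarith
  rw [div_le_iff₀ (by positivity)] at this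
  linarith

/-- For L = 0 the quadratic majorant is affine. If the gradient were nonzero, the chosen step along
its negative would bring the value down to at most `m - 1`. -/
lemma IsSmoothLoss.gradient_eq_zero (hg : IsSmoothLoss g 0) {m : ℝ} (hm : ∀ z, m ≤ g z)
    (x : Params p q) : gradient g x = 0 := by
  by_contra h
  have hpos : 0 < ‖gradient g x‖ ^ 2 := by positivity
  have key := (hm _).trans (hg.le_quadratic x
    (x - ((g x - m + 1) / ‖gradient g x‖ ^ 2) • gradient g x))
  rw [sub_sub_cancel_left, inner_neg_right, inner_smul_right, real_inner_self_eq_norm_sq,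
    div_mul_cancel₀ _ hpos.ne'] at key
  linarith

/-- Quadratic growth makes the loss integrable at square integrable models. -/
lemma IsSmoothLoss.abs_le_quadratic (hg : IsSmoothLoss g L) (x : Params p q) :
    |g x| ≤ |g 0| + ‖gradient g 0‖ * ‖x‖ + |L| / 2 * ‖x‖ ^ 2 := by
  have h1 := hg.le_quadratic 0 x
  have h2 := hg.quadratic_le 0 x
  rw [sub_zero] at h1 h2
  have h3 := abs_le.1 (abs_real_inner_le_norm (gradient g 0) x)
  have h4 := abs_le.1 (le_refl |g 0|)
  have h5 : L / 2 * ‖x‖ ^ 2 ≤ |L| / 2 * ‖x‖ ^ 2 := by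
    have := le_abs_self L
    gcongr
  rw [abs_le]
  constructor <;> linarith

end Smooth

/-! ### Averages over the workers, and the objective as such an average -/

section Average

variable {E : Type*} [NormedAddCommGroup E] {N : ℕ}

lemma sq_norm_average_le [NormedSpace ℝ E] (hN : 0 < N) (v : Fin N → E) :
    ‖(1 / (N : ℝ)) • ∑ i, v i‖ ^ 2 ≤ 1 / (N : ℝ) * ∑ i, ‖v i‖ ^ 2 := by
  have hN' : (0 : ℝ) < N := by exact_mod_cast hN
  rw [norm_smul, mul_pow, Real.norm_eq_abs, sq_abs]
  have h1 : ‖∑ i, v i‖ ^ 2 ≤ (∑ i, ‖v i‖) ^ 2 := by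
    have := norm_sum_le Finset.univ v
    gcongr
  have h2 := sq_sum_le_card_mul_sum_sq (s := Finset.univ) (f := fun i => ‖v i‖)
  rw [Finset.card_univ, Fintype.card_fin] at h2
  calc (1 / (N : ℝ)) ^ 2 * ‖∑ i, v i‖ ^ 2 ≤ (1 / (N : ℝ)) ^ 2 * (N * ∑ i, ‖v i‖ ^ 2) := by
        gcongr
        exact h1.trans h2
    _ = _ := by field_simp

/-- The deviations from the average sum to zero, so the cross term vanishes. Any convenient
reference point may thus replace the average. -/
lemma sum_norm_sub_average_sq_le [InnerProductSpace ℝ E] (hN : 0 < N) (v : Fin N → E) (c : E) :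
    ∑ i, ‖v i - (1 / (N : ℝ)) • ∑ j, v j‖ ^ 2 ≤ ∑ i, ‖v i - c‖ ^ 2 := by
  have hN' : (0 : ℝ) < N := by exact_mod_cast hN
  set a := (1 / (N : ℝ)) • ∑ j, v j with ha
  have hsum : ∑ i, (v i - a) = 0 := by
    rw [Finset.sum_sub_distrib, Finset.sum_const, Finset.card_univ, Fintype.card_fin, ha,
      ← Nat.cast_smul_eq_nsmul ℝ, smul_smul, mul_one_div_cancel hN'.ne', one_smul, sub_self]
  have : ∑ i, ‖v i - c‖ ^ 2 = ∑ i, ‖v i - a‖ ^ 2 + N * ‖a - c‖ ^ 2 := by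
    have e : ∀ i, ‖v i - c‖ ^ 2 = ‖v i - a‖ ^ 2 + 2 * inner ℝ (v i - a) (a - c) + ‖a - c‖ ^ 2 := by
      intro i
      rw [← norm_add_sq_real, sub_add_sub_cancel]
    simp only [e, Finset.sum_add_distrib, ← Finset.mul_sum, ← sum_inner, hsum, inner_zero_left]
    simp
  rw [this]
  have : 0 ≤ (N : ℝ) * ‖a - c‖ ^ 2 := by positivity
  linarith

end Average

namespace Run

variable {N p q : ℕ} {Ξ Ω : Type*} [MeasurableSpace Ξ] [MeasurableSpace Ω] {r : Run N p q Ξ Ω}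
  {L sigma zeta rho delta : ℝ}

lemma Assumptions.one_lt (h : r.Assumptions L sigma zeta rho delta) : 1 < N := by
  obtain ⟨_, hN, _⟩ := h.mixing.gap
  simpa using hN

lemma Assumptions.gradient_loss (h : r.Assumptions L sigma zeta rho delta) (x : Params p q) :
    gradient r.loss x = (1 / (N : ℝ)) • ∑ i, gradient (r.lossOf i) x := by
  have h1 : HasFDerivAt (fun x => (1 / (N : ℝ)) * ∑ i, r.lossOf i x)
      ((1 / (N : ℝ)) • ∑ i, fderiv ℝ (r.lossOf i) x) x := by
    refine HasFDerivAt.const_mul ?_ _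
    exact HasFDerivAt.fun_sum fun i _ => ((h.smooth i).differentiable x).hasFDerivAt
  have h2 : fderiv ℝ r.loss x = (1 / (N : ℝ)) • ∑ i, fderiv ℝ (r.lossOf i) x := h1.fderiv
  simp only [gradient, h2, map_smul, map_sum]

lemma Assumptions.smooth_loss (h : r.Assumptions L sigma zeta rho delta) :
    IsSmoothLoss r.loss L := by
  have hN : (0 : ℝ) < N := by exact_mod_cast (zero_lt_one.trans h.one_lt)
  constructor
  · have : Differentiable ℝ (fun x => (1 / (N : ℝ)) * ∑ i, r.lossOf i x) :=
      (Differentiable.fun_sum fun i _ => (h.smooth i).differentiable).const_mul _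
    exact this
  · intro X Y
    rw [h.gradient_loss, h.gradient_loss, ← smul_sub, ← Finset.sum_sub_distrib, norm_smul,
      Real.norm_of_nonneg (by positivity)]
    have : ‖∑ i, (gradient (r.lossOf i) X - gradient (r.lossOf i) Y)‖ ≤ ∑ i : Fin N, L * ‖X - Y‖ :=
      (norm_sum_le _ _).trans (Finset.sum_le_sum fun i _ => (h.smooth i).lipschitz_grad X Y)
    rw [Finset.sum_const, Finset.card_univ, Fintype.card_fin, nsmul_eq_mul] at this
    calc _ ≤ 1 / (N : ℝ) * (N * (L * ‖X - Y‖)) := by gcongr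
      _ = _ := by field_simp

end Run

/-! ### Random vectors -/

section RandomVectors

variable {Ω : Type*} {mΩ : MeasurableSpace Ω} {P : Measure Ω}
  {E : Type*} [NormedAddCommGroup E]

lemma MeasureTheory.MemLp.integrable_sq_norm {f : Ω → E} (hf : MemLp f 2 P) :
    Integrable (fun ω => ‖f ω‖ ^ 2) P :=
  (memLp_two_iff_integrable_sq_norm hf.1).1 hf

lemma MeasureTheory.MemLp.integrable_real_inner [InnerProductSpace ℝ E] {f g : Ω → E}
    (hf : MemLp f 2 P) (hg : MemLp g 2 P) : Integrable (fun ω => (inner ℝ (f ω) (g ω) : ℝ)) P := by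
  refine (hf.integrable_sq_norm.add hg.integrable_sq_norm).mono' (hf.1.inner hg.1)
    (Filter.Eventually.of_forall fun ω => ?_)
  have h1 := abs_real_inner_le_norm (f ω) (g ω)
  rw [Real.norm_eq_abs, Pi.add_apply]
  nlinarith [sq_nonneg (‖f ω‖ - ‖g ω‖), sq_nonneg (‖f ω‖ + ‖g ω‖)]

lemma memLp_fin_sum {ι : Type*} (s : Finset ι) {f : ι → Ω → E} (hf : ∀ i ∈ s, MemLp (f i) 2 P) :
    MemLp (fun ω => ∑ i ∈ s, f i ω) 2 P := memLp_finsetSum s hf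

variable {α Ξ : Type*} {mα : MeasurableSpace α} {mΞ : MeasurableSpace Ξ}

section Independence

variable {Z : Ω → α} {ξ : Ω → Ξ} {D : Measure Ξ} [MeasurableSpace E] [BorelSpace E]
  [SecondCountableTopology E] {G : α × Ξ → E} {s2 : ℝ}

/-- By independence the joint law is a product, so Fubini integrates over the data point first, with
the parameters frozen; the bound uniform in the parameters then survives. -/
lemma ProbabilityTheory.IndepFun.memLp_comp [IsProbabilityMeasure P] (hind : IndepFun Z ξ P)
    (hZ : Measurable Z) (hξ : Measurable ξ) (hlaw : P.map ξ = D) (hG : Measurable G)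
    (hL2 : ∀ z, MemLp (fun s => G (z, s)) 2 D) (hs : ∀ z, ∫ s, ‖G (z, s)‖ ^ 2 ∂D ≤ s2) :
    MemLp (fun ω => G (Z ω, ξ ω)) 2 P ∧ ∫ ω, ‖G (Z ω, ξ ω)‖ ^ 2 ∂P ≤ s2 := by
  have : IsProbabilityMeasure (P.map Z) := Measure.isProbabilityMeasure_map hZ.aemeasurable
  have hD : IsProbabilityMeasure D := hlaw ▸ Measure.isProbabilityMeasure_map hξ.aemeasurable
  have hmap : P.map (fun ω => (Z ω, ξ ω)) = (P.map Z).prod D := by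
    rw [← hlaw]
    exact (indepFun_iff_map_prod_eq_prod_map_map hZ.aemeasurable hξ.aemeasurable).1 hind
  have hGn : Measurable (fun z => ‖G z‖ ^ 2) := hG.norm.pow_const 2
  have hint : Integrable (fun z => ‖G z‖ ^ 2) ((P.map Z).prod D) := by
    rw [integrable_prod_iff hGn.aestronglyMeasurable]
    refine ⟨Filter.Eventually.of_forall fun z => (hL2 z).integrable_sq_norm, ?_⟩
    refine Integrable.of_bound (C := s2) ?_ (Filter.Eventually.of_forall fun z => ?_)
    · exact (hGn.aestronglyMeasurable.norm (μ := (P.map Z).prod D)).integral_prod_right'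
    · simp only [norm_pow, norm_norm]
      rw [Real.norm_of_nonneg (integral_nonneg fun s => by positivity)]
      exact hs z
  have hpair : Measurable (fun ω => (Z ω, ξ ω)) := hZ.prodMk hξ
  constructor
  · refine (memLp_two_iff_integrable_sq_norm (hG.comp hpair).aestronglyMeasurable).2 ?_
    rw [← hmap] at hint
    exact hint.comp_measurable hpair
  · have : ∫ ω, ‖G (Z ω, ξ ω)‖ ^ 2 ∂P = ∫ z, ‖G z‖ ^ 2 ∂((P.map Z).prod D) := by
      rw [← hmap, integral_map hpair.aemeasurable hGn.aestronglyMeasurable]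
    rw [this, integral_prod _ hint]
    calc _ ≤ ∫ _ : α, s2 ∂(P.map Z) :=
          integral_mono hint.integral_prod_left (integrable_const _) hs
      _ = s2 := by simp

lemma ProbabilityTheory.IndepFun.integral_inner_eq_zero [InnerProductSpace ℝ E] [CompleteSpace E]
    [IsProbabilityMeasure P] (hind : IndepFun Z ξ P)
    (hZ : Measurable Z) (hξ : Measurable ξ) (hlaw : P.map ξ = D) (hG : Measurable G)
    (hL2 : ∀ z, MemLp (fun s => G (z, s)) 2 D) (hmean : ∀ z, ∫ s, G (z, s) ∂D = 0)
    {h : α → E} (hh : Measurable h)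
    (hint : Integrable (fun ω => (inner ℝ (h (Z ω)) (G (Z ω, ξ ω)) : ℝ)) P) :
    ∫ ω, inner ℝ (h (Z ω)) (G (Z ω, ξ ω)) ∂P = 0 := by
  have : IsProbabilityMeasure (P.map Z) := Measure.isProbabilityMeasure_map hZ.aemeasurable
  have hD : IsProbabilityMeasure D := hlaw ▸ Measure.isProbabilityMeasure_map hξ.aemeasurable
  have hmap : P.map (fun ω => (Z ω, ξ ω)) = (P.map Z).prod D := by
    rw [← hlaw]
    exact (indepFun_iff_map_prod_eq_prod_map_map hZ.aemeasurable hξ.aemeasurable).1 hind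
  have hpair : Measurable (fun ω => (Z ω, ξ ω)) := hZ.prodMk hξ
  have hm : Measurable (fun z : α × Ξ => (inner ℝ (h z.1) (G z) : ℝ)) :=
    (hh.comp measurable_fst).inner hG
  have hint' : Integrable (fun z : α × Ξ => (inner ℝ (h z.1) (G z) : ℝ)) ((P.map Z).prod D) := by
    rw [← hmap, integrable_map_measure hm.aestronglyMeasurable hpair.aemeasurable]
    exact hint
  have : ∫ ω, (inner ℝ (h (Z ω)) (G (Z ω, ξ ω)) : ℝ) ∂P
      = ∫ z, inner ℝ (h z.1) (G z) ∂((P.map Z).prod D) := by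
    rw [← hmap, integral_map hpair.aemeasurable hm.aestronglyMeasurable]
  rw [this, integral_prod _ hint']
  have hz : ∀ z, ∫ s, (inner ℝ (h z) (G (z, s)) : ℝ) ∂D = 0 := fun z => by
    rw [integral_inner ((hL2 z).integrable one_le_two), hmean, inner_zero_right]
  simp [hz]

end Independence

/-- Associativity of product measures. It serves with the models for `X` and the samples of two
workers for `U` and `V`. -/
lemma ProbabilityTheory.IndepFun.prodMk_left_of_indepFun {β γ : Type*} {mβ : MeasurableSpace β}
    {mγ : MeasurableSpace γ} [IsProbabilityMeasure P] {X : Ω → α} {U : Ω → β} {V : Ω → γ}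
    (hX : Measurable X) (hU : Measurable U) (hV : Measurable V)
    (h : IndepFun X (fun ω => (U ω, V ω)) P) (hUV : IndepFun U V P) :
    IndepFun (fun ω => (X ω, U ω)) V P := by
  have : IsProbabilityMeasure (P.map X) := Measure.isProbabilityMeasure_map hX.aemeasurable
  have : IsProbabilityMeasure (P.map U) := Measure.isProbabilityMeasure_map hU.aemeasurable
  have : IsProbabilityMeasure (P.map V) := Measure.isProbabilityMeasure_map hV.aemeasurable
  have h1 := (indepFun_iff_map_prod_eq_prod_map_map hX.aemeasurable
    (hU.prodMk hV).aemeasurable).1 h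
  have h2 := (indepFun_iff_map_prod_eq_prod_map_map hU.aemeasurable hV.aemeasurable).1 hUV
  have h3 : IndepFun X U P := h.comp measurable_id measurable_fst
  have h4 := (indepFun_iff_map_prod_eq_prod_map_map hX.aemeasurable hU.aemeasurable).1 h3
  rw [indepFun_iff_map_prod_eq_prod_map_map (hX.prodMk hU).aemeasurable hV.aemeasurable, h4]
  have h5 := (measurePreserving_prodAssoc (P.map X) (P.map U) (P.map V)).symm.map_eq
  rw [← h5, ← h2, ← h1, Measure.map_map (MeasurableEquiv.measurable _) (hX.prodMk (hU.prodMk hV))]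
  rfl

end RandomVectors

/-! ### Compressors -/

section Compressors

variable {p q : ℕ}

lemma IsStarProjection.norm_apply_sq {C : Params p q →L[ℝ] Params p q} (hC : IsStarProjection C)
    (x : Params p q) : ‖C x‖ ^ 2 = inner ℝ x (C x) := by
  have h1 : C (C x) = C x := by
    have := congrArg (fun T : Params p q →L[ℝ] Params p q => T x) hC.isIdempotentElem.eq
    simpa using this
  have h2 : ContinuousLinearMap.adjoint C = C := by
    have := hC.isSelfAdjoint.star_eq
    rwa [ContinuousLinearMap.star_eq_adjoint] at this
  rw [← real_inner_self_eq_norm_sq]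
  conv_lhs => rw [← ContinuousLinearMap.adjoint_inner_right, h2, h1]

lemma IsStarProjection.norm_apply_le {C : Params p q →L[ℝ] Params p q} (hC : IsStarProjection C)
    (x : Params p q) : ‖C x‖ ≤ ‖x‖ := by
  have h1 := hC.norm_apply_sq x
  have h2 := real_inner_le_norm x (C x)
  rcases (norm_nonneg (C x)).eq_or_lt with h | h
  · rw [← h]; positivity
  · rw [← h1, sq] at h2
    exact le_of_mul_le_mul_right h2 h

/-- A random linear contraction with conditional mean `delta` acts as `delta` in expectation on
square integrable vectors that are known. -/
lemma integral_inner_apply_eq {Ω : Type*} {m mΩ : MeasurableSpace Ω} (hm : m ≤ mΩ) {P : Measure Ω}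
    [IsProbabilityMeasure P] {C : Ω → (Params p q →L[ℝ] Params p q)} {delta : ℝ}
    (hCm : Measurable C) (hC : ∀ᵐ ω ∂P, IsStarProjection (C ω))
    (hmean : ∀ X : Params p q, P[fun ω => C ω X | m] =ᵐ[P] fun _ => delta • X)
    {h Z : Ω → Params p q} (hh : Measurable[m] h) (hZ : Measurable[m] Z)
    (hh2 : MemLp h 2 P) (hZ2 : MemLp Z 2 P) :
    ∫ ω, inner ℝ (h ω) (C ω (Z ω)) ∂P = delta * ∫ ω, inner ℝ (h ω) (Z ω) ∂P := by
  -- Unbiasedness is assumed for fixed vectors only. Expanding `Z` in the standard basis leaves the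
  -- compressor acting on fixed vectors, while the coordinates of `Z` join the known factor `h`.
  set e : Fin p × Fin q → Params p q := fun k => EuclideanSpace.basisFun _ ℝ k with he
  have hexp : ∀ x : Params p q, x = ∑ k, x k • e k := fun x => by
    conv_lhs => rw [← (EuclideanSpace.basisFun (Fin p × Fin q) ℝ).sum_repr x]
    simp [he]
  have hZk : ∀ k, Measurable[m] (fun ω => Z ω k) := fun k =>
    (by fun_prop : Continuous fun x : Params p q => x k).measurable.comp hZ
  have hf : ∀ k, Measurable[m] (fun ω => Z ω k • h ω) := fun k => (hZk k).smul hh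
  have hZk2 : ∀ k, MemLp (fun ω => Z ω k) 2 P := fun k =>
    hZ2.of_le ((hZk k).mono hm le_rfl).aestronglyMeasurable
      (Filter.Eventually.of_forall fun ω => PiLp.norm_apply_le (Z ω) k)
  have hf1 : ∀ k, Integrable (fun ω => Z ω k • h ω) P := fun k =>
    memLp_one_iff_integrable.1 (hh2.smul (p := 2) (q := 2) (r := 1) (hZk2 k))
  have hCe : ∀ k, Measurable (fun ω => C ω (e k)) := fun k =>
    (ContinuousLinearMap.apply ℝ (Params p q) (e k)).continuous.measurable.comp hCm
  have hCb : ∀ k, ∀ᵐ ω ∂P, ‖C ω (e k)‖ ≤ ‖e k‖ := fun k => by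
    filter_upwards [hC] with ω hω using hω.norm_apply_le _
  have hCi : ∀ k, Integrable (fun ω => C ω (e k)) P := fun k =>
    Integrable.of_bound (hCe k).aestronglyMeasurable _ (hCb k)
  -- The known factor, a product of two square integrable functions, is only integrable; boundedness
  -- of the compressed basis vectors makes the pairing integrable.
  have hfC : ∀ k, Integrable (fun ω => (inner ℝ (Z ω k • h ω) (C ω (e k)) : ℝ)) P := fun k => by
    refine ((hf1 k).norm.mul_const ‖e k‖).mono'
      ((hf1 k).1.inner (hCe k).aestronglyMeasurable) ?_
    filter_upwards [hCb k] with ω hω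
    refine (norm_inner_le_norm _ _).trans ?_
    gcongr
  have hfe : ∀ k, Integrable (fun ω => (inner ℝ (Z ω k • h ω) (e k) : ℝ)) P := fun k =>
    (hf1 k).inner_const _
  have hterm : ∀ k, ∫ ω, (inner ℝ (Z ω k • h ω) (C ω (e k)) : ℝ) ∂P
      = delta * ∫ ω, inner ℝ (Z ω k • h ω) (e k) ∂P := fun k => by
    have hpull := condExp_bilin_of_stronglyMeasurable_left (μ := P) (innerSL ℝ)
      (hf k).stronglyMeasurable (hfC k) (hCi k)
    rw [← integral_const_mul]
    calc _ = ∫ ω, (P[fun ω => (innerSL ℝ (Z ω k • h ω)) (C ω (e k)) | m]) ω ∂P :=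
          (integral_condExp hm).symm
      _ = _ := by
          refine integral_congr_ae ?_
          filter_upwards [hpull, hmean (e k)] with ω h1 h2
          rw [h1, h2]
          exact real_inner_smul_right (Z ω k • h ω) (e k) delta
  have e1 : ∀ ω, (inner ℝ (h ω) (C ω (Z ω)) : ℝ) = ∑ k, inner ℝ (Z ω k • h ω) (C ω (e k)) := by
    intro ω
    conv_lhs => rw [hexp (Z ω)]
    simp only [map_sum, map_smul, inner_sum, real_inner_smul_left, real_inner_smul_right]
  have e2 : ∀ ω, (inner ℝ (h ω) (Z ω) : ℝ) = ∑ k, inner ℝ (Z ω k • h ω) (e k) := by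
    intro ω
    conv_lhs => rw [hexp (Z ω)]
    simp only [inner_sum, inner_smul_right, real_inner_smul_left]
  simp only [e1, e2]
  rw [integral_finsetSum _ fun k _ => hfC k, integral_finsetSum _ fun k _ => hfe k,
    Finset.mul_sum]
  exact Finset.sum_congr rfl fun k _ => hterm k

end Compressors

/-! ### The random process generated by the algorithm -/

/-- The average over the nodes. -/
def nodeAverage {N : ℕ} {E : Type*} [AddCommGroup E] [Module ℝ E] (X : Fin N → E) : E :=
  (1 / (N : ℝ)) • ∑ i, X i

/-- The deviation from the average over the nodes. -/
def nodeDeviation {N : ℕ} {E : Type*} [AddCommGroup E] [Module ℝ E] (X : Fin N → E)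
    (i : Fin N) : E := X i - nodeAverage X

section NodeAverage

variable {N : ℕ} {E : Type*} [AddCommGroup E] [Module ℝ E]

lemma sum_nodeDeviation (hN : 0 < N) (X : Fin N → E) : ∑ i, nodeDeviation X i = 0 := by
  have hN' : (N : ℝ) ≠ 0 := by exact_mod_cast hN.ne'
  simp only [nodeDeviation, nodeAverage, Finset.sum_sub_distrib]
  rw [Finset.sum_const, Finset.card_univ, Fintype.card_fin, ← Nat.cast_smul_eq_nsmul ℝ, smul_smul,
    mul_one_div_cancel hN', one_smul, sub_self]

lemma nodeAverage_sub_smul (X g : Fin N → E) (e : ℝ) :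
    nodeAverage (fun i => X i - e • g i) = nodeAverage X - e • nodeAverage g := by
  simp only [nodeAverage, Finset.sum_sub_distrib, ← Finset.smul_sum, smul_sub, smul_comm e]

lemma nodeAverage_add (X g : Fin N → E) :
    nodeAverage (fun i => X i + g i) = nodeAverage X + nodeAverage g := by
  simp only [nodeAverage, Finset.sum_add_distrib, smul_add]

end NodeAverage

lemma measurable_sub_smul_stochGrad {p q : ℕ} {Ξ α : Type*} [MeasurableSpace Ξ]
    {mα : MeasurableSpace α} {F : Params p q → Ξ → ℝ}
    (hF : Measurable (fun z : Params p q × Ξ => stochGrad F z.1 z.2)) (e : ℝ) {x : α → Params p q}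
    {s : α → Ξ} (hx : Measurable x) (hs : Measurable s) :
    Measurable (fun a => x a - e • stochGrad F (x a) (s a)) :=
  hx.sub ((hF.comp (hx.prodMk hs)).const_smul e)

lemma measurable_clm_apply {p q : ℕ} {α : Type*} {mα : MeasurableSpace α}
    {C : α → (Params p q →L[ℝ] Params p q)} {x : α → Params p q}
    (hC : Measurable C) (hx : Measurable x) : Measurable (fun a => C a (x a)) :=
  ContinuousLinearMap.measurable_apply₂.comp (hC.prodMk hx)

namespace Run

variable {N p q : ℕ} {Ξ Ω : Type*} [MeasurableSpace Ξ] [mΩ : MeasurableSpace Ω]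
  {r : Run N p q Ξ Ω} {L sigma zeta rho delta : ℝ}

section Filtration

lemma samplesOf_le (h : r.FreshSamples) (t : ℕ) : r.samplesOf t ≤ mΩ :=
  iSup_le fun i => (h.measurable t i).comap_le

lemma compsOf_le (h : r.CompressorsOK delta) (t : ℕ) : r.compsOf t ≤ mΩ :=
  iSup_le fun i => iSup_le fun j => (h.measurable t i j).comap_le

lemma Assumptions.history_le (h : r.Assumptions L sigma zeta rho delta) (t : ℕ) :
    r.history t ≤ mΩ :=
  iSup₂_le fun s _ => sup_le (samplesOf_le h.samples s) (compsOf_le h.compressors s)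

lemma history_le_succ (r : Run N p q Ξ Ω) (t : ℕ) : r.history t ≤ r.history (t + 1) :=
  iSup₂_le fun s hs => le_iSup₂_of_le (f := fun s _ => r.samplesOf s ⊔ r.compsOf s) s
    (Finset.mem_range.2 ((Finset.mem_range.1 hs).trans t.lt_succ_self)) le_rfl

lemma round_le_history_succ (r : Run N p q Ξ Ω) (t : ℕ) :
    r.samplesOf t ⊔ r.compsOf t ≤ r.history (t + 1) :=
  le_iSup₂_of_le (f := fun s _ => r.samplesOf s ⊔ r.compsOf s) t
    (Finset.mem_range.2 t.lt_succ_self) le_rfl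

lemma measurable_sample (r : Run N p q Ξ Ω) (t : ℕ) (i : Fin N) :
    Measurable[r.samplesOf t] (r.sample t i) :=
  (comap_measurable _).mono (le_iSup (fun i => MeasurableSpace.comap (r.sample t i) _) i) le_rfl

lemma measurable_comp (r : Run N p q Ξ Ω) (t : ℕ) (i j : Fin N) :
    Measurable[r.compsOf t] (r.comp t i j) :=
  (comap_measurable _).mono (le_iSup₂_of_le
    (f := fun i j => MeasurableSpace.comap (r.comp t i j) _) i j le_rfl) le_rfl

end Filtration

/-- The local models of round `t`, before the consensus step. -/
def localModel (r : Run N p q Ξ Ω) (eta : ℕ → ℝ) (t : ℕ) (ω : Ω) : Fin N → Params p q :=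
  r.localStep eta t ω (r.iterate eta ω t)

/-- The error of the stochastic gradient of worker `i` in round `t`. -/
def noise (r : Run N p q Ξ Ω) (eta : ℕ → ℝ) (t : ℕ) (ω : Ω) (i : Fin N) : Params p q :=
  stochGrad (r.F i) (r.iterate eta ω t i) (r.sample t i ω)
    - gradient (r.lossOf i) (r.iterate eta ω t i)

/-- The gradients of the local losses at the models of round `t`. -/
def localGradient (r : Run N p q Ξ Ω) (eta : ℕ → ℝ) (t : ℕ) (ω : Ω) (i : Fin N) : Params p q :=
  gradient (r.lossOf i) (r.iterate eta ω t i)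

lemma localModel_eq (r : Run N p q Ξ Ω) (eta : ℕ → ℝ) (t : ℕ) (ω : Ω) :
    r.localModel eta t ω = fun i => r.iterate eta ω t i
      - eta t • (r.localGradient eta t ω i + r.noise eta t ω i) := by
  funext i
  simp [localModel, localStep, localGradient, noise]

variable {eta : ℕ → ℝ}

/-- Measurability of the models is a hypothesis here because the lemma serves inside the induction
that proves it. -/
lemma Assumptions.measurable_localModel_of (h : r.Assumptions L sigma zeta rho delta) {t : ℕ}
    (hX : ∀ i, Measurable[r.history t] (fun ω => r.iterate eta ω t i)) (i : Fin N) :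
    Measurable[r.history t ⊔ r.samplesOf t] (fun ω => r.localModel eta t ω i) :=
  measurable_sub_smul_stochGrad (h.oracle i).measurable_grad (eta t)
    ((hX i).mono le_sup_left le_rfl) ((r.measurable_sample t i).mono le_sup_right le_rfl)

lemma Assumptions.measurable_iterate_history (h : r.Assumptions L sigma zeta rho delta) (t : ℕ) :
    ∀ i, Measurable[r.history t] (fun ω => r.iterate eta ω t i) := by
  induction t with
  | zero => exact fun i => measurable_const
  | succ t ih =>
    have hround := r.round_le_history_succ t
    have hY : ∀ i, Measurable[r.history (t + 1)] (fun ω => r.localModel eta t ω i) := fun i =>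
      (h.measurable_localModel_of ih i).mono
        (sup_le (r.history_le_succ t) (le_sup_left.trans hround)) le_rfl
    have hC : ∀ i j, Measurable[r.history (t + 1)] (r.comp t i j) := fun i j =>
      (r.measurable_comp t i j).mono (le_sup_right.trans hround) le_rfl
    intro i
    refine (hY i).add (Finset.measurable_fun_sum _ fun j _ => ?_)
    exact ((measurable_clm_apply (hC i j) (hY j)).sub
      (measurable_clm_apply (hC i j) (hY i))).const_smul (r.W i j)

lemma Assumptions.measurable_localModel (h : r.Assumptions L sigma zeta rho delta) (t : ℕ)
    (i : Fin N) : Measurable[r.history t ⊔ r.samplesOf t] (fun ω => r.localModel eta t ω i) :=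
  h.measurable_localModel_of (h.measurable_iterate_history t) i

lemma Assumptions.measurable_iterate (h : r.Assumptions L sigma zeta rho delta) (t : ℕ)
    (i : Fin N) : Measurable (fun ω => r.iterate eta ω t i) :=
  (h.measurable_iterate_history t i).mono (h.history_le t) le_rfl

/-! ### Gradient noise: moments and orthogonality -/

section Noise

/-- The error of the stochastic gradient at given parameters and a given data point. -/
def gradError (r : Run N p q Ξ Ω) (i : Fin N) (z : Params p q × Ξ) : Params p q :=
  stochGrad (r.F i) z.1 z.2 - gradient (r.lossOf i) z.1

lemma Assumptions.measurable_gradError (h : r.Assumptions L sigma zeta rho delta) (i : Fin N) :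
    Measurable (r.gradError i) :=
  (h.oracle i).measurable_grad.sub
    ((h.smooth i).continuous_gradient.measurable.comp measurable_fst)

lemma Assumptions.memLp_gradError (h : r.Assumptions L sigma zeta rho delta) (i : Fin N)
    (x : Params p q) : MemLp (fun s => r.gradError i (x, s)) 2 (r.D i) := by
  have := (h.oracle i).prob
  exact ((h.oracle i).square_integrable x).sub
    (memLp_const (gradient (r.lossOf i) x))

lemma Assumptions.integral_gradError (h : r.Assumptions L sigma zeta rho delta) (i : Fin N)
    (x : Params p q) : ∫ s, r.gradError i (x, s) ∂(r.D i) = 0 := by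
  have := (h.oracle i).prob
  have h1 := ((h.oracle i).square_integrable x).integrable one_le_two
  simp only [gradError]
  rw [integral_sub h1 (integrable_const _), (h.oracle i).unbiased]
  simp [lossOf]

/-- All the models of round `t`. -/
lemma Assumptions.measurable_models_history (h : r.Assumptions L sigma zeta rho delta) (t : ℕ) :
    Measurable[r.history t] (fun ω => r.iterate eta ω t) :=
  @measurable_pi_lambda Ω (Fin N) (fun _ => Params p q) (r.history t) _ _
    fun i => h.measurable_iterate_history t i

lemma Assumptions.measurable_models (h : r.Assumptions L sigma zeta rho delta) (t : ℕ) :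
    Measurable (fun ω => r.iterate eta ω t) :=
  (h.measurable_models_history t).mono (h.history_le t) le_rfl

lemma Assumptions.indepFun_models (h : r.Assumptions L sigma zeta rho delta) (t : ℕ) {β : Type*}
    [MeasurableSpace β] {S : Ω → β} (hS : Measurable[r.samplesOf t] S) :
    IndepFun (fun ω => r.iterate eta ω t) S r.P := by
  rw [IndepFun_iff_Indep]
  exact indep_of_indep_of_le_left (indep_of_indep_of_le_right (h.samples.indep_past t).symm
    hS.comap_le) (h.measurable_models_history t).comap_le

lemma Assumptions.noise_bound (h : r.Assumptions L sigma zeta rho delta) (t : ℕ) (i : Fin N) :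
    MemLp (fun ω => r.noise eta t ω i) 2 r.P ∧ ∫ ω, ‖r.noise eta t ω i‖ ^ 2 ∂r.P ≤ sigma ^ 2 := by
  have := h.prob
  have hind : IndepFun (fun ω => r.iterate eta ω t i) (r.sample t i) r.P :=
    (h.indepFun_models (eta := eta) t (r.measurable_sample t i)).comp (measurable_pi_apply i)
      measurable_id
  exact hind.memLp_comp (h.measurable_iterate t i) (h.samples.measurable t i) (h.samples.law t i)
    (h.measurable_gradError i) (h.memLp_gradError i) (h.oracle i).variance_le

lemma Assumptions.memLp_noise (h : r.Assumptions L sigma zeta rho delta) (t : ℕ) (i : Fin N) :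
    MemLp (fun ω => r.noise eta t ω i) 2 r.P := (h.noise_bound t i).1

/-- `H` may depend on the models of all workers, since all of them are determined by the history and
the samples of the round are independent of it. -/
lemma Assumptions.integral_inner_noise (h : r.Assumptions L sigma zeta rho delta) (t : ℕ)
    (i : Fin N) {H : (Fin N → Params p q) → Params p q} (hH : Measurable H)
    (hH2 : MemLp (fun ω => H (r.iterate eta ω t)) 2 r.P) :
    ∫ ω, inner ℝ (H (r.iterate eta ω t)) (r.noise eta t ω i) ∂r.P = 0 := by
  have := h.prob
  exact (h.indepFun_models (eta := eta) t (r.measurable_sample t i)).integral_inner_eq_zero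
    (G := fun z : (Fin N → Params p q) × Ξ => r.gradError i (z.1 i, z.2)) (h.measurable_models t)
    (h.samples.measurable t i) (h.samples.law t i)
    ((h.measurable_gradError i).comp
      (((measurable_pi_apply i).comp measurable_fst).prodMk measurable_snd))
    (fun z => h.memLp_gradError i (z i)) (fun z => h.integral_gradError i (z i)) hH
    (hH2.integrable_real_inner (h.memLp_noise t i))

/-- Both noises depend on the common history, so they need not be independent. Still, the sample of
`j` is independent of the models and the sample of `i` jointly, and averaging over it first gives
zero. -/
lemma Assumptions.integral_inner_noise_noise (h : r.Assumptions L sigma zeta rho delta) (t : ℕ)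
    {i j : Fin N} (hij : i ≠ j) :
    ∫ ω, inner ℝ (r.noise eta t ω i) (r.noise eta t ω j) ∂r.P = 0 := by
  have := h.prob
  have h1 : IndepFun (fun ω => (r.iterate eta ω t, r.sample t i ω)) (r.sample t j) r.P :=
    IndepFun.prodMk_left_of_indepFun (h.measurable_models t) (h.samples.measurable t i)
      (h.samples.measurable t j)
      (h.indepFun_models t ((r.measurable_sample t i).prodMk (r.measurable_sample t j)))
      ((h.samples.indep_workers t).indepFun hij)
  exact h1.integral_inner_eq_zero
    (G := fun z : ((Fin N → Params p q) × Ξ) × Ξ => r.gradError j (z.1.1 j, z.2))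
    (h := fun z : (Fin N → Params p q) × Ξ => r.gradError i (z.1 i, z.2))
    ((h.measurable_models t).prodMk (h.samples.measurable t i))
    (h.samples.measurable t j) (h.samples.law t j)
    ((h.measurable_gradError j).comp (((measurable_pi_apply j).comp
      (measurable_fst.comp measurable_fst)).prodMk measurable_snd))
    (fun z => h.memLp_gradError j (z.1 j)) (fun z => h.integral_gradError j (z.1 j))
    ((h.measurable_gradError i).comp
      (((measurable_pi_apply i).comp measurable_fst).prodMk measurable_snd))
    ((h.memLp_noise t i).integrable_real_inner (h.memLp_noise t j))

lemma memLp_nodeAverage {X : Ω → Fin N → Params p q} {P : Measure Ω}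
    (hX : ∀ i, MemLp (fun ω => X ω i) 2 P) : MemLp (fun ω => nodeAverage (X ω)) 2 P :=
  (memLp_fin_sum Finset.univ fun i _ => hX i).const_smul (1 / (N : ℝ))

lemma memLp_nodeDeviation {X : Ω → Fin N → Params p q} {P : Measure Ω}
    (hX : ∀ i, MemLp (fun ω => X ω i) 2 P) (i : Fin N) :
    MemLp (fun ω => nodeDeviation (X ω) i) 2 P :=
  (hX i).sub (memLp_nodeAverage hX)

lemma Assumptions.integral_inner_average_noise (h : r.Assumptions L sigma zeta rho delta) (t : ℕ)
    {H : (Fin N → Params p q) → Params p q} (hH : Measurable H)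
    (hH2 : MemLp (fun ω => H (r.iterate eta ω t)) 2 r.P) :
    ∫ ω, inner ℝ (H (r.iterate eta ω t)) (nodeAverage (r.noise eta t ω)) ∂r.P = 0 := by
  simp only [nodeAverage, inner_smul_right, inner_sum]
  rw [integral_const_mul, integral_finsetSum _ fun i _ =>
    hH2.integrable_real_inner (h.memLp_noise t i)]
  simp [h.integral_inner_noise t _ hH hH2]

/-- Only the N diagonal terms of the double sum survive. This is the origin of the speed-up linear
in N. -/
lemma Assumptions.integral_norm_average_noise_sq_le (h : r.Assumptions L sigma zeta rho delta)
    (t : ℕ) : ∫ ω, ‖nodeAverage (r.noise eta t ω)‖ ^ 2 ∂r.P ≤ sigma ^ 2 / N := by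
  have hN : (0 : ℝ) < N := by exact_mod_cast (zero_lt_one.trans h.one_lt)
  have e : ∀ ω, ‖nodeAverage (r.noise eta t ω)‖ ^ 2
      = (1 / (N : ℝ)) ^ 2 * ∑ i, ∑ j, inner ℝ (r.noise eta t ω i) (r.noise eta t ω j) := by
    intro ω
    rw [nodeAverage, norm_smul, mul_pow, Real.norm_eq_abs, sq_abs, ← real_inner_self_eq_norm_sq,
      sum_inner]
    simp only [inner_sum]
  have hi : ∀ i j, Integrable (fun ω => (inner ℝ (r.noise eta t ω i) (r.noise eta t ω j) : ℝ)) r.P :=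
    fun i j => (h.memLp_noise t i).integrable_real_inner (h.memLp_noise t j)
  simp only [e]
  rw [integral_const_mul, integral_finsetSum _ fun i _ => integrable_finsetSum _ fun j _ => hi i j]
  have h1 : ∀ i, ∫ ω, ∑ j, inner ℝ (r.noise eta t ω i) (r.noise eta t ω j) ∂r.P ≤ sigma ^ 2 := by
    intro i
    rw [integral_finsetSum _ fun j _ => hi i j, Finset.sum_eq_single i
      (fun j _ hj => h.integral_inner_noise_noise t hj.symm) (by simp)]
    simp only [real_inner_self_eq_norm_sq]
    exact (h.noise_bound t i).2
  calc _ ≤ (1 / (N : ℝ)) ^ 2 * ∑ _i : Fin N, sigma ^ 2 := by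
        gcongr with i _
        exact h1 i
    _ = _ := by
        rw [Finset.sum_const, Finset.card_univ, Fintype.card_fin, nsmul_eq_mul]
        field_simp

end Noise

end Run

/-! ### The consensus step and the consensus distance -/

namespace Run

variable {N p q : ℕ} {Ξ Ω : Type*} [MeasurableSpace Ξ] [mΩ : MeasurableSpace Ω]
  {r : Run N p q Ξ Ω} {L sigma zeta rho delta : ℝ} {eta : ℕ → ℝ}

section Integrability

lemma IsSmoothLoss.memLp_gradient {g : Params p q → ℝ} (hg : IsSmoothLoss g L) {P : Measure Ω}
    [IsFiniteMeasure P] {X : Ω → Params p q} (hX : MemLp X 2 P) :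
    MemLp (fun ω => gradient g (X ω)) 2 P := by
  have h1 : MemLp (fun ω => gradient g (X ω) - gradient g 0) 2 P := by
    refine MemLp.of_le_mul (c := L) hX
      ((hg.continuous_gradient.comp_aestronglyMeasurable hX.1).sub aestronglyMeasurable_const)
      (Filter.Eventually.of_forall fun ω => ?_)
    simpa using hg.lipschitz_grad (X ω) 0
  have h2 := h1.add (memLp_const (gradient g 0))
  refine h2.congr_norm (hg.continuous_gradient.comp_aestronglyMeasurable hX.1)
    (Filter.Eventually.of_forall fun ω => ?_)
  simp

lemma Assumptions.memLp_comp_apply (h : r.Assumptions L sigma zeta rho delta) {t : ℕ} {i j : Fin N}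
    (hij : r.G.Adj i j) {Y : Ω → Params p q} (hYm : Measurable Y) (hY : MemLp Y 2 r.P) :
    MemLp (fun ω => r.comp t i j ω (Y ω)) 2 r.P := by
  refine hY.of_le
    (measurable_clm_apply (h.compressors.measurable t i j) hYm).aestronglyMeasurable ?_
  filter_upwards [h.compressors.projection t i j hij] with ω hω using hω.norm_apply_le _

lemma Assumptions.measurable_localModel_ambient (h : r.Assumptions L sigma zeta rho delta) (t : ℕ)
    (i : Fin N) : Measurable (fun ω => r.localModel eta t ω i) :=
  (h.measurable_localModel t i).mono (sup_le (h.history_le t) (samplesOf_le h.samples t)) le_rfl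

lemma Assumptions.memLp_localModel_of (h : r.Assumptions L sigma zeta rho delta) {t : ℕ}
    (hX : ∀ i, MemLp (fun ω => r.iterate eta ω t i) 2 r.P) (i : Fin N) :
    MemLp (fun ω => r.localModel eta t ω i) 2 r.P := by
  have := h.prob
  simp only [localModel_eq]
  exact (hX i).sub (((IsSmoothLoss.memLp_gradient (h.smooth i) (hX i)).add
    (h.memLp_noise t i)).const_smul (eta t))

lemma Assumptions.memLp_iterate (h : r.Assumptions L sigma zeta rho delta) (t : ℕ) :
    ∀ i, MemLp (fun ω => r.iterate eta ω t i) 2 r.P := by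
  have := h.prob
  induction t with
  | zero => exact fun i => memLp_const _
  | succ t ih =>
    classical
    intro i
    have hY := h.memLp_localModel_of ih
    have hYm := fun i => h.measurable_localModel_ambient (eta := eta) t i
    refine (hY i).add (memLp_fin_sum _ fun j hj => ?_)
    have hij := (Finset.mem_filter.1 hj).2
    exact ((h.memLp_comp_apply hij (hYm j) (hY j)).sub
      (h.memLp_comp_apply hij (hYm i) (hY i))).const_smul (r.W i j)

lemma Assumptions.memLp_localModel (h : r.Assumptions L sigma zeta rho delta) (t : ℕ) (i : Fin N) :
    MemLp (fun ω => r.localModel eta t ω i) 2 r.P :=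
  h.memLp_localModel_of (h.memLp_iterate t) i

lemma Assumptions.memLp_localGradient (h : r.Assumptions L sigma zeta rho delta) (t : ℕ)
    (i : Fin N) : MemLp (fun ω => r.localGradient eta t ω i) 2 r.P :=
  have := h.prob
  IsSmoothLoss.memLp_gradient (h.smooth i) (h.memLp_iterate t i)

lemma integrable_gossipEnergy {W : Matrix (Fin N) (Fin N) ℝ} {P : Measure Ω}
    {V : Ω → Fin N → Params p q} (hV : ∀ i, MemLp (fun ω => V ω i) 2 P) :
    Integrable (fun ω => gossipEnergy W (V ω)) P := by
  unfold gossipEnergy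
  refine ((integrable_finsetSum _ fun i _ => (hV i).integrable_sq_norm).const_mul _).add
    ((integrable_finsetSum _ fun i _ => integrable_finsetSum _ fun j _ => ?_).const_mul _)
  exact (((hV i).add (hV j)).integrable_sq_norm).const_mul _

lemma memLp_gossipDual {W : Matrix (Fin N) (Fin N) ℝ} {P : Measure Ω}
    {V : Ω → Fin N → Params p q} (hV : ∀ i, MemLp (fun ω => V ω i) 2 P) (i j : Fin N) :
    MemLp (fun ω => gossipDual W (V ω) i j) 2 P := by
  unfold gossipDual
  exact ((((hV i).const_smul (3 : ℝ)).add
    (memLp_fin_sum _ fun k _ => (hV k).const_smul (W i k))).const_smul (2 : ℝ)).add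
    (((hV j).sub (hV i)).const_smul (2 : ℝ))

end Integrability

/-! ### One gossip round: the mean is conserved, the energy contracts -/

section Consensus

open Classical in
/-- What node `i` receives over the link to `j` in the consensus step. -/
def flow (r : Run N p q Ξ Ω) (t : ℕ) (ω : Ω) (Y : Fin N → Params p q) (i j : Fin N) : Params p q :=
  if r.G.Adj i j then r.comp t i j ω (Y j - Y i) else 0

/-- The compressors of round `t` are shared orthogonal projections. -/
def GoodRound (r : Run N p q Ξ Ω) (t : ℕ) (ω : Ω) : Prop :=
  ∀ i j, r.G.Adj i j → r.comp t i j ω = r.comp t j i ω ∧ IsStarProjection (r.comp t i j ω)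

lemma Assumptions.ae_goodRound (h : r.Assumptions L sigma zeta rho delta) (t : ℕ) :
    ∀ᵐ ω ∂r.P, r.GoodRound t ω := by
  refine ae_all_iff.2 fun i => ae_all_iff.2 fun j => ?_
  by_cases hij : r.G.Adj i j
  · filter_upwards [h.compressors.shared t i j hij, h.compressors.projection t i j hij]
      with ω h1 h2 _ using ⟨h1, h2⟩
  · exact Filter.Eventually.of_forall fun ω h => absurd h hij

lemma consensusStep_eq (r : Run N p q Ξ Ω) (t : ℕ) (ω : Ω) (Y : Fin N → Params p q) :
    r.consensusStep t ω Y = fun i => Y i + ∑ j, r.W i j • r.flow t ω Y i j := by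
  funext i
  rw [consensusStep, Finset.sum_filter]
  congr 1
  refine Finset.sum_congr rfl fun j _ => ?_
  unfold flow
  split_ifs <;> simp

variable {t : ℕ} {ω : Ω}

lemma GoodRound.flow_antisymm (hg : r.GoodRound t ω) (Y : Fin N → Params p q) (i j : Fin N) :
    r.flow t ω Y j i = -r.flow t ω Y i j := by
  unfold flow
  by_cases hij : r.G.Adj i j
  · rw [if_pos hij, if_pos hij.symm, (hg i j hij).1, ← map_neg, neg_sub]
  · rw [if_neg hij, if_neg fun h => hij h.symm, neg_zero]

lemma GoodRound.sum_flow (hg : r.GoodRound t ω) (hs : r.W.IsSymm) (Y : Fin N → Params p q) :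
    ∑ i, ∑ j, r.W i j • r.flow t ω Y i j = 0 := by
  have h1 := IsSymm.sum_swap hs (fun i j => r.flow t ω Y i j)
  have h2 : ∑ i, ∑ j, r.W i j • r.flow t ω Y j i = -∑ i, ∑ j, r.W i j • r.flow t ω Y i j := by
    simp only [← Finset.sum_neg_distrib, ← smul_neg]
    exact Finset.sum_congr rfl fun i _ => Finset.sum_congr rfl fun j _ => by
      rw [hg.flow_antisymm Y i j]
  have h3 := eq_neg_iff_add_eq_zero.1 (h1.trans h2)
  rw [← two_smul ℝ] at h3
  exact (smul_eq_zero.1 h3).resolve_left two_ne_zero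

/-- Symmetric weights against an antisymmetric flow sum to zero. -/
lemma GoodRound.nodeAverage_consensusStep (hg : r.GoodRound t ω) (hs : r.W.IsSymm)
    (Y : Fin N → Params p q) : nodeAverage (r.consensusStep t ω Y) = nodeAverage Y := by
  rw [consensusStep_eq, nodeAverage_add]
  conv_lhs => rhs; rw [nodeAverage, hg.sum_flow hs, smul_zero]
  rw [add_zero]

lemma GoodRound.energy_consensusStep_le (hg : r.GoodRound t ω)
    (hmix : IsMixing r.G r.W rho) (Y : Fin N → Params p q) :
    gossipEnergy r.W (nodeDeviation (r.consensusStep t ω Y))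
      ≤ gossipEnergy r.W (nodeDeviation Y)
        + ∑ i, ∑ j, r.W i j * inner ℝ (gossipDual r.W (nodeDeviation Y) i j) (r.flow t ω Y i j) := by
  have e : nodeDeviation (r.consensusStep t ω Y)
      = fun i => nodeDeviation Y i + ∑ j, r.W i j • r.flow t ω Y i j := by
    funext i
    rw [nodeDeviation, hg.nodeAverage_consensusStep hmix.symm, consensusStep_eq, nodeDeviation]
    exact add_sub_right_comm _ _ _
  rw [e]
  refine gossipEnergy_add_divergence_le hmix.symm hmix.doubly_stochastic _ _
    (fun i j _ => hg.flow_antisymm Y i j) fun i j _ => ?_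
  have e2 : nodeDeviation Y j - nodeDeviation Y i = Y j - Y i := by simp [nodeDeviation]
  rw [e2]
  unfold flow
  split_ifs with hij
  · exact (hg i j hij).2.norm_apply_sq _
  · simp

lemma Assumptions.memLp_flow (h : r.Assumptions L sigma zeta rho delta) (t : ℕ) (i j : Fin N) :
    MemLp (fun ω => r.flow t ω (r.localModel eta t ω) i j) 2 r.P := by
  unfold flow
  by_cases hij : r.G.Adj i j
  · simp only [if_pos hij]
    exact h.memLp_comp_apply hij ((h.measurable_localModel_ambient t j).sub
      (h.measurable_localModel_ambient t i)) ((h.memLp_localModel t j).sub (h.memLp_localModel t i))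
  · simp only [if_neg hij]
    exact MemLp.zero'

lemma Assumptions.integral_flow (h : r.Assumptions L sigma zeta rho delta) (t : ℕ) (i j : Fin N) :
    r.W i j * ∫ ω, inner ℝ (gossipDual r.W (nodeDeviation (r.localModel eta t ω)) i j)
        (r.flow t ω (r.localModel eta t ω) i j) ∂r.P
      = delta * (r.W i j * ∫ ω, inner ℝ (gossipDual r.W (nodeDeviation (r.localModel eta t ω)) i j)
          (nodeDeviation (r.localModel eta t ω) j - nodeDeviation (r.localModel eta t ω) i) ∂r.P) := by
  have := h.prob
  simp only [nodeDeviation, sub_sub_sub_cancel_right]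
  by_cases hij : r.G.Adj i j
  · have hYm : Measurable[r.history t ⊔ r.samplesOf t] (fun ω => r.localModel eta t ω) :=
      @measurable_pi_lambda Ω (Fin N) (fun _ => Params p q) (r.history t ⊔ r.samplesOf t) _ _
        fun i => h.measurable_localModel t i
    have hdual : Measurable fun Y : Fin N → Params p q =>
        gossipDual r.W (fun i => Y i - nodeAverage Y) i j := by
      refine Continuous.measurable ?_
      unfold gossipDual nodeAverage
      fun_prop
    have key := integral_inner_apply_eq
      (sup_le (h.history_le t) (samplesOf_le h.samples t)) (h.compressors.measurable t i j)
      (h.compressors.projection t i j hij) (h.compressors.unbiased t i j hij)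
      (hdual.comp hYm) ((h.measurable_localModel (eta := eta) t j).sub
        (h.measurable_localModel (eta := eta) t i))
      (memLp_gossipDual (memLp_nodeDeviation fun i => h.memLp_localModel (eta := eta) t i) i j)
      ((h.memLp_localModel (eta := eta) t j).sub (h.memLp_localModel (eta := eta) t i))
    simp only [flow, if_pos hij]
    rw [mul_left_comm]
    exact congrArg _ key
  -- Nothing is assumed of compressors off the edges. There either the weight vanishes or `i = j`,
  -- where both the flow and the difference are zero.
  · by_cases hW : r.W i j = 0
    · simp [hW]
    · rcases h.mixing.support i j hW with rfl | h'
      · simp [flow]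
      · exact absurd h' hij

/-- The pathwise bound is affine in the flow, so each link is integrated by itself and the joint law
of the compressors is never used. -/
lemma Assumptions.integral_energy_succ_le (h : r.Assumptions L sigma zeta rho delta)
    (hdelta : 0 ≤ delta) (t : ℕ) :
    ∫ ω, gossipEnergy r.W (nodeDeviation (r.iterate eta ω (t + 1))) ∂r.P
      ≤ (1 - rho * delta / 2)
        * ∫ ω, gossipEnergy r.W (nodeDeviation (r.localModel eta t ω)) ∂r.P := by
  have hN := zero_lt_one.trans h.one_lt
  have hV : ∀ i, MemLp (fun ω => nodeDeviation (r.localModel eta t ω) i) 2 r.P :=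
    memLp_nodeDeviation fun i => h.memLp_localModel t i
  have hX : ∀ i, MemLp (fun ω => nodeDeviation (r.iterate eta ω (t + 1)) i) 2 r.P :=
    memLp_nodeDeviation fun i => h.memLp_iterate (t + 1) i
  have hI1 : ∀ i j, Integrable (fun ω => r.W i j * inner ℝ
      (gossipDual r.W (nodeDeviation (r.localModel eta t ω)) i j)
      (r.flow t ω (r.localModel eta t ω) i j)) r.P := fun i j =>
    ((memLp_gossipDual hV i j).integrable_real_inner (h.memLp_flow t i j)).const_mul _
  have hI2 : ∀ i j, Integrable (fun ω => r.W i j * inner ℝ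
      (gossipDual r.W (nodeDeviation (r.localModel eta t ω)) i j)
      (nodeDeviation (r.localModel eta t ω) j - nodeDeviation (r.localModel eta t ω) i)) r.P :=
    fun i j => ((memLp_gossipDual hV i j).integrable_real_inner ((hV j).sub (hV i))).const_mul _
  have hS1 := integrable_finsetSum Finset.univ fun i _ =>
    integrable_finsetSum Finset.univ fun j _ => hI1 i j
  have hS2 := (integrable_finsetSum Finset.univ fun i _ =>
    integrable_finsetSum Finset.univ fun j _ => hI2 i j).const_mul delta
  have hE := integrable_gossipEnergy (W := r.W) hV
  calc _ ≤ ∫ ω, (gossipEnergy r.W (nodeDeviation (r.localModel eta t ω))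
        + ∑ i, ∑ j, r.W i j * inner ℝ (gossipDual r.W (nodeDeviation (r.localModel eta t ω)) i j)
            (r.flow t ω (r.localModel eta t ω) i j)) ∂r.P := by
        refine integral_mono_ae (integrable_gossipEnergy hX) (hE.add hS1) ?_
        filter_upwards [h.ae_goodRound t] with ω hω
        exact hω.energy_consensusStep_le h.mixing _
    _ = ∫ ω, (gossipEnergy r.W (nodeDeviation (r.localModel eta t ω))
        + delta * ∑ i, ∑ j, r.W i j
          * inner ℝ (gossipDual r.W (nodeDeviation (r.localModel eta t ω)) i j)
            (nodeDeviation (r.localModel eta t ω) j - nodeDeviation (r.localModel eta t ω) i)) ∂r.P := by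
        rw [integral_add hE hS1, integral_add hE hS2, integral_const_mul,
          integral_finsetSum _ fun i _ => integrable_finsetSum _ fun j _ => hI1 i j,
          integral_finsetSum _ fun i _ => integrable_finsetSum _ fun j _ => hI2 i j, Finset.mul_sum]
        congr 1
        refine Finset.sum_congr rfl fun i _ => ?_
        rw [integral_finsetSum _ fun j _ => hI1 i j, integral_finsetSum _ fun j _ => hI2 i j,
          Finset.mul_sum]
        refine Finset.sum_congr rfl fun j _ => ?_
        rw [integral_const_mul, integral_const_mul]
        exact h.integral_flow t i j
    _ ≤ _ := by
        rw [← integral_const_mul]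
        refine integral_mono (hE.add hS2) (hE.const_mul _) fun ω => ?_
        exact gossipEnergy_mean_step_le h.mixing hdelta (sum_nodeDeviation hN _)

/-- The mean of the models moves by the mean stochastic gradient. -/
lemma Assumptions.ae_nodeAverage_succ (h : r.Assumptions L sigma zeta rho delta) (t : ℕ) :
    ∀ᵐ ω ∂r.P, nodeAverage (r.iterate eta ω (t + 1)) = nodeAverage (r.iterate eta ω t)
      - eta t • (nodeAverage (r.localGradient eta t ω) + nodeAverage (r.noise eta t ω)) := by
  filter_upwards [h.ae_goodRound t] with ω hω
  rw [← nodeAverage_add, ← nodeAverage_sub_smul, ← localModel_eq]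
  exact hω.nodeAverage_consensusStep h.mixing.symm _

end Consensus

/-! ### The consensus distance under local steps and gossip -/

section Distance

lemma norm_add_three_sq_le {E : Type*} [NormedAddCommGroup E] (x y z : E) :
    ‖x + y + z‖ ^ 2 ≤ 3 * (‖x‖ ^ 2 + ‖y‖ ^ 2 + ‖z‖ ^ 2) := by
  have h1 := norm_add₃_le (a := x) (b := y) (c := z)
  nlinarith [norm_nonneg (x + y + z), sq_nonneg (‖x‖ - ‖y‖), sq_nonneg (‖x‖ - ‖z‖),
    sq_nonneg (‖y‖ - ‖z‖), norm_nonneg x, norm_nonneg y, norm_nonneg z]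

/-- Measured from the gradient of the objective at the mean model, a stochastic gradient has three
errors: noise, displacement from the mean, and heterogeneity. The constant 12 is 4 (upper bound of
the energy) times 3 (three summands); the lower bound of the energy turns it into 6 for the
displacement. -/
lemma Assumptions.energy_stochastic_gradient_le (h : r.Assumptions L sigma zeta rho delta)
    (t : ℕ) (ω : Ω) :
    gossipEnergy r.W (nodeDeviation fun i => r.localGradient eta t ω i + r.noise eta t ω i)
      ≤ 12 * ∑ i, ‖r.noise eta t ω i‖ ^ 2
        + 6 * L ^ 2 * gossipEnergy r.W (nodeDeviation (r.iterate eta ω t)) + 12 * N * zeta ^ 2 := by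
  have hN := zero_lt_one.trans h.one_lt
  have hN' : (0 : ℝ) < N := by exact_mod_cast hN
  have hW := h.mixing.doubly_stochastic
  set X := r.iterate eta ω t with hX
  set c := nodeAverage X with hc
  have h1 := gossipEnergy_upper hW
    (nodeDeviation fun i => r.localGradient eta t ω i + r.noise eta t ω i)
  have h2 := sum_norm_sub_average_sq_le hN
    (fun i => r.localGradient eta t ω i + r.noise eta t ω i) (gradient r.loss c)
  have h3 : ∀ i, ‖r.localGradient eta t ω i + r.noise eta t ω i - gradient r.loss c‖ ^ 2
      ≤ 3 * (‖r.noise eta t ω i‖ ^ 2 + L ^ 2 * ‖nodeDeviation X i‖ ^ 2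
        + ‖gradient (r.lossOf i) c - gradient r.loss c‖ ^ 2) := by
    intro i
    have e : r.localGradient eta t ω i + r.noise eta t ω i - gradient r.loss c
        = r.noise eta t ω i + (gradient (r.lossOf i) (X i) - gradient (r.lossOf i) c)
          + (gradient (r.lossOf i) c - gradient r.loss c) := by
      rw [localGradient]; abel
    rw [e]
    refine (norm_add_three_sq_le _ _ _).trans ?_
    have := (h.smooth i).lipschitz_grad (X i) c
    have := pow_le_pow_left₀ (norm_nonneg _) this 2
    rw [mul_pow] at this
    unfold nodeDeviation
    linarith
  have h4 := Finset.sum_le_sum fun i (_ : i ∈ Finset.univ) => h3 i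
  rw [← Finset.mul_sum, Finset.sum_add_distrib, Finset.sum_add_distrib, ← Finset.mul_sum] at h4
  have h5 := h.heterogeneity c
  rw [one_div, inv_mul_le_iff₀ hN'] at h5
  have h6 := mul_le_mul_of_nonneg_left (gossipEnergy_lower hW (nodeDeviation X)) (sq_nonneg L)
  unfold nodeDeviation nodeAverage at *
  linarith

lemma Assumptions.integral_energy_local_le (h : r.Assumptions L sigma zeta rho delta)
    {th : ℝ} (hth : 0 < th) (t : ℕ) :
    ∫ ω, gossipEnergy r.W (nodeDeviation (r.localModel eta t ω)) ∂r.P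
      ≤ (1 + th) * ∫ ω, gossipEnergy r.W (nodeDeviation (r.iterate eta ω t)) ∂r.P
        + (1 + 1 / th) * eta t ^ 2 * (12 * N * (zeta ^ 2 + sigma ^ 2)
          + 6 * L ^ 2 * ∫ ω, gossipEnergy r.W (nodeDeviation (r.iterate eta ω t)) ∂r.P) := by
  have := h.prob
  have hW := h.mixing.doubly_stochastic
  have hV := integrable_gossipEnergy (W := r.W)
    (memLp_nodeDeviation fun i => h.memLp_localModel (eta := eta) t i)
  have hX := integrable_gossipEnergy (W := r.W)
    (memLp_nodeDeviation fun i => h.memLp_iterate (eta := eta) t i)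
  have hn : Integrable (fun ω => ∑ i, ‖r.noise eta t ω i‖ ^ 2) r.P :=
    integrable_finsetSum _ fun i _ => (h.memLp_noise t i).integrable_sq_norm
  have hns : ∫ ω, ∑ i, ‖r.noise eta t ω i‖ ^ 2 ∂r.P ≤ N * sigma ^ 2 := by
    rw [integral_finsetSum _ fun i _ => (h.memLp_noise t i).integrable_sq_norm]
    refine (Finset.sum_le_sum fun i _ => (h.noise_bound t i).2).trans ?_
    simp
  set k := (1 + 1 / th) * eta t ^ 2 with hk
  have hk0 : 0 ≤ k := by positivity
  have hpt : ∀ ω, gossipEnergy r.W (nodeDeviation (r.localModel eta t ω))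
      ≤ (1 + th + k * (6 * L ^ 2)) * gossipEnergy r.W (nodeDeviation (r.iterate eta ω t))
        + k * 12 * ∑ i, ‖r.noise eta t ω i‖ ^ 2 + k * (12 * N * zeta ^ 2) := by
    intro ω
    have e : nodeDeviation (r.localModel eta t ω) = fun i => nodeDeviation (r.iterate eta ω t) i
        - eta t • nodeDeviation (fun i => r.localGradient eta t ω i + r.noise eta t ω i) i := by
      funext i
      rw [localModel_eq, nodeDeviation, nodeAverage_sub_smul, nodeDeviation, nodeDeviation, smul_sub]
      abel
    rw [e]
    refine (gossipEnergy_sub_smul_le hW hth _ _ _).trans ?_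
    have := mul_le_mul_of_nonneg_left (h.energy_stochastic_gradient_le (eta := eta) t ω) hk0
    linarith
  have hA := hX.const_mul (1 + th + k * (6 * L ^ 2))
  have hB := hn.const_mul (k * 12)
  have hC : Integrable (fun _ : Ω => k * (12 * N * zeta ^ 2)) r.P := integrable_const _
  have hAB : Integrable (fun ω =>
      (1 + th + k * (6 * L ^ 2)) * gossipEnergy r.W (nodeDeviation (r.iterate eta ω t))
        + k * 12 * ∑ i, ‖r.noise eta t ω i‖ ^ 2) r.P := hA.add hB
  have := integral_mono hV (hAB.add hC) hpt
  have e : ∫ ω, ((1 + th + k * (6 * L ^ 2)) * gossipEnergy r.W (nodeDeviation (r.iterate eta ω t))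
        + k * 12 * ∑ i, ‖r.noise eta t ω i‖ ^ 2 + k * (12 * N * zeta ^ 2)) ∂r.P
      = (1 + th + k * (6 * L ^ 2))
          * ∫ ω, gossipEnergy r.W (nodeDeviation (r.iterate eta ω t)) ∂r.P
        + k * 12 * ∫ ω, ∑ i, ‖r.noise eta t ω i‖ ^ 2 ∂r.P + k * (12 * N * zeta ^ 2) := by
    rw [integral_add hAB hC, integral_add hA hB, integral_const_mul, integral_const_mul]
    simp
  have h2 := mul_le_mul_of_nonneg_left hns hk0
  refine (this.trans e.le).trans ?_
  linarith

/-- With a small constant stepsize the energy of the deviations stays bounded. -/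
lemma Assumptions.integral_energy_le (h : r.Assumptions L sigma zeta rho delta) (hL : 0 ≤ L)
    (hdelta : 0 < delta) (ha : rho * delta ≤ 1) {e : ℝ} (he : 0 < e)
    (hstep : 32 * L * e ≤ rho * delta) (t : ℕ) :
    ∫ ω, gossipEnergy r.W (nodeDeviation (r.iterate (fun _ => e) ω t)) ∂r.P
      ≤ 384 * N * e ^ 2 * (zeta ^ 2 + sigma ^ 2) / (rho * delta) ^ 2 := by
  have := h.prob
  set a := rho * delta with had
  have ha0 : 0 < a := mul_pos h.mixing.gap_pos hdelta
  have hN := zero_lt_one.trans h.one_lt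
  set s := (N : ℝ) * (zeta ^ 2 + sigma ^ 2) with hs
  have hs0 : 0 ≤ s := by positivity
  induction t with
  | zero =>
    have hN' : (N : ℝ) ≠ 0 := by exact_mod_cast hN.ne'
    have e0 : nodeDeviation (fun _ : Fin N => r.X0) = fun _ => 0 := by
      funext i
      rw [nodeDeviation, nodeAverage, Finset.sum_const, Finset.card_univ, Fintype.card_fin,
        ← Nat.cast_smul_eq_nsmul ℝ, smul_smul, one_div_mul_cancel hN', one_smul, sub_self]
    simp only [iterate, e0, gossipEnergy]
    simp
    positivity
  | succ t ih =>
    have h1 := h.integral_energy_succ_le (eta := fun _ => e) hdelta.le t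
    -- With `a = ρδ`, the Young parameter `a / 4` spends half of the contraction `a / 2`. The
    -- gradient displacement spends at most another `a / 8`, by the stepsize condition. The factor
    -- `1 - a / 8` remains, with additive term `48 * e ^ 2 * s / a`, and its fixed point carries the
    -- constant 8 · 48 = 384.
    have h2 := h.integral_energy_local_le (eta := fun _ => e) (th := a / 4) (by positivity) t
    set psi := ∫ ω, gossipEnergy r.W (nodeDeviation (r.iterate (fun _ => e) ω t)) ∂r.P
    have hpsi : 0 ≤ psi := integral_nonneg fun ω =>
      le_trans (by positivity) (gossipEnergy_lower h.mixing.doubly_stochastic _)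
    rw [← had] at h1
    refine h1.trans ((mul_le_mul_of_nonneg_left h2 (by linarith)).trans ?_)
    have hsq : 1024 * (L ^ 2 * e ^ 2) ≤ a ^ 2 := by
      have := pow_le_pow_left₀ (by positivity) hstep 2
      nlinarith
    have hB : 384 * N * e ^ 2 * (zeta ^ 2 + sigma ^ 2) / a ^ 2 = 384 * e ^ 2 * s / a ^ 2 := by
      rw [hs]; ring
    rw [hB] at ih ⊢
    have hcoef : (1 - a / 2) * (1 + 1 / (a / 4)) ≤ 4 / a := by
      have : (1 - a / 2) * (1 + 1 / (a / 4)) = 4 / a - (1 + a / 2) := by field_simp; ring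
      rw [this]; linarith
    have hcoef2 : (1 - a / 2) * (1 + a / 4) ≤ 1 - a / 4 := by nlinarith
    have h3 : 6 * L ^ 2 * psi * e ^ 2 * (4 / a) ≤ a / 8 * psi := by
      have : 6 * L ^ 2 * psi * e ^ 2 * (4 / a) = 24 * (L ^ 2 * e ^ 2) * psi / a := by ring
      rw [this, div_le_iff₀ ha0]
      nlinarith
    have hX : 0 ≤ e ^ 2 * (12 * s + 6 * L ^ 2 * psi) := by positivity
    calc (1 - a / 2) * ((1 + a / 4) * psi + (1 + 1 / (a / 4)) * e ^ 2
            * (12 * N * (zeta ^ 2 + sigma ^ 2) + 6 * L ^ 2 * psi))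
        = (1 - a / 2) * (1 + a / 4) * psi + (1 - a / 2) * (1 + 1 / (a / 4))
            * (e ^ 2 * (12 * s + 6 * L ^ 2 * psi)) := by rw [hs]; ring
      _ ≤ (1 - a / 4) * psi + 4 / a * (e ^ 2 * (12 * s + 6 * L ^ 2 * psi)) := by gcongr
      _ ≤ (1 - a / 8) * psi + 48 * e ^ 2 * s / a := by
          have : 4 / a * (e ^ 2 * (12 * s + 6 * L ^ 2 * psi))
            = 48 * e ^ 2 * s / a + 6 * L ^ 2 * psi * e ^ 2 * (4 / a) := by ring
          rw [this]; linarith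
      _ ≤ (1 - a / 8) * (384 * e ^ 2 * s / a ^ 2) + 48 * e ^ 2 * s / a := by
          have : 0 ≤ 1 - a / 8 := by linarith
          gcongr
      _ = _ := by field_simp; ring

/-- The expected consensus distance with a small constant stepsize. -/
lemma Assumptions.integral_consensus_le (h : r.Assumptions L sigma zeta rho delta) (hL : 0 ≤ L)
    (hsigma : 0 ≤ sigma) (hzeta : 0 ≤ zeta)
    (hdelta : 0 < delta) (ha : rho * delta ≤ 1) {e : ℝ} (he : 0 < e)
    (hstep : 32 * L * e ≤ rho * delta) (t : ℕ) :
    ∫ ω, 1 / (N : ℝ) * ∑ i, ‖nodeDeviation (r.iterate (fun _ => e) ω t) i‖ ^ 2 ∂r.P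
      ≤ 192 * (e * (zeta + sigma) / (rho * delta)) ^ 2 := by
  have hN : (0 : ℝ) < N := by exact_mod_cast (zero_lt_one.trans h.one_lt)
  have h1 := h.integral_energy_le hL hdelta ha he hstep t
  have hdev := memLp_nodeDeviation fun i => h.memLp_iterate (eta := fun _ => e) t i
  have h2 : ∫ ω, 1 / (N : ℝ) * ∑ i, ‖nodeDeviation (r.iterate (fun _ => e) ω t) i‖ ^ 2 ∂r.P
      ≤ ∫ ω, 1 / (2 * N : ℝ) * gossipEnergy r.W (nodeDeviation (r.iterate (fun _ => e) ω t)) ∂r.P := by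
    refine integral_mono ((integrable_finsetSum _ fun i _ => (hdev i).integrable_sq_norm).const_mul _)
      ((integrable_gossipEnergy hdev).const_mul _) fun ω => ?_
    have := gossipEnergy_lower h.mixing.doubly_stochastic
      (nodeDeviation (r.iterate (fun _ => e) ω t))
    calc 1 / (N : ℝ) * ∑ i, ‖nodeDeviation (r.iterate (fun _ => e) ω t) i‖ ^ 2
        = 1 / (2 * N : ℝ) * (2 * ∑ i, ‖nodeDeviation (r.iterate (fun _ => e) ω t) i‖ ^ 2) := by
          field_simp
      _ ≤ _ := by gcongr
  rw [integral_const_mul (1 / (2 * N : ℝ))] at h2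
  have ha0 : 0 < rho * delta := mul_pos h.mixing.gap_pos hdelta
  calc _ ≤ 1 / (2 * N : ℝ) * (384 * N * e ^ 2 * (zeta ^ 2 + sigma ^ 2) / (rho * delta) ^ 2) :=
        h2.trans (by gcongr)
    _ = 192 * e ^ 2 * (zeta ^ 2 + sigma ^ 2) / (rho * delta) ^ 2 := by field_simp; ring
    _ ≤ 192 * e ^ 2 * (zeta + sigma) ^ 2 / (rho * delta) ^ 2 := by
        gcongr
        nlinarith [mul_nonneg hzeta hsigma]
    _ = _ := by ring

end Distance

end Run

/-! ### Progress of the mean model -/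

namespace Run

variable {N p q : ℕ} {Ξ Ω : Type*} [MeasurableSpace Ξ] [mΩ : MeasurableSpace Ω]
  {r : Run N p q Ξ Ω} {L sigma zeta rho delta : ℝ} {eta : ℕ → ℝ}

section Deterministic

lemma Assumptions.norm_average_gradient_sub_sq_le (h : r.Assumptions L sigma zeta rho delta)
    (X : Fin N → Params p q) :
    ‖nodeAverage (fun i => gradient (r.lossOf i) (X i)) - gradient r.loss (nodeAverage X)‖ ^ 2
      ≤ L ^ 2 * (1 / (N : ℝ) * ∑ i, ‖nodeDeviation X i‖ ^ 2) := by
  have hN := zero_lt_one.trans h.one_lt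
  have e : nodeAverage (fun i => gradient (r.lossOf i) (X i)) - gradient r.loss (nodeAverage X)
      = (1 / (N : ℝ)) • ∑ i, (gradient (r.lossOf i) (X i)
          - gradient (r.lossOf i) (nodeAverage X)) := by
    rw [h.gradient_loss, Finset.sum_sub_distrib, smul_sub]
    rfl
  rw [e]
  refine (sq_norm_average_le hN _).trans ?_
  rw [mul_left_comm, Finset.mul_sum (a := L ^ 2)]
  refine mul_le_mul_of_nonneg_left (Finset.sum_le_sum fun i _ => ?_) (by positivity)
  rw [← mul_pow]
  exact pow_le_pow_left₀ (norm_nonneg _) ((h.smooth i).lipschitz_grad _ _) 2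

/-- For each worker the direction from the minimizer to the mean passes through its own model:
convexity handles the part from the minimizer to the model, smoothness the part from the model to
the mean. The values at the model cancel, and Jensen's inequality moves the quadratic term to the
mean. -/
lemma Assumptions.inner_average_gradient_ge (h : r.Assumptions L sigma zeta rho delta) {mu : ℝ}
    (hmu : 0 ≤ mu) (hconv : ∀ i, IsMuConvex mu r.loss (r.lossOf i)) {Xs : Params p q}
    (hXs : IsMinimizer r.loss Xs) (X : Fin N → Params p q) :
    r.loss (nodeAverage X) - r.loss Xs + mu / 2 * ‖nodeAverage X - Xs‖ ^ 2
        - L / 2 * (1 / (N : ℝ) * ∑ i, ‖nodeDeviation X i‖ ^ 2)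
      ≤ inner ℝ (nodeAverage (fun i => gradient (r.lossOf i) (X i))) (nodeAverage X - Xs) := by
  have hN := zero_lt_one.trans h.one_lt
  have hN' : (0 : ℝ) < N := by exact_mod_cast hN
  set c := nodeAverage X with hc
  have hterm : ∀ i, r.lossOf i c - r.lossOf i Xs + mu / 2 * ‖X i - Xs‖ ^ 2
      - L / 2 * ‖nodeDeviation X i‖ ^ 2 ≤ inner ℝ (gradient (r.lossOf i) (X i)) (c - Xs) := by
    intro i
    have h1 := hconv i (X i) Xs hXs
    have h2 := (h.smooth i).le_quadratic (X i) c
    have e1 : (inner ℝ (gradient (r.lossOf i) (X i)) (c - Xs) : ℝ)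
        = inner ℝ (gradient (r.lossOf i) (X i)) (c - X i)
          - inner ℝ (gradient (r.lossOf i) (X i)) (Xs - X i) := by
      rw [← inner_sub_right, sub_sub_sub_cancel_right]
    rw [norm_sub_rev c (X i)] at h2
    rw [e1, nodeDeviation, ← hc]
    linarith
  have hsum := mul_le_mul_of_nonneg_left (Finset.sum_le_sum fun i (_ : i ∈ Finset.univ) => hterm i)
    (one_div_pos.2 hN').le
  have hj := sq_norm_average_le hN (fun i => X i - Xs)
  have e2 : (1 / (N : ℝ)) • ∑ i, (X i - Xs) = c - Xs := by
    rw [Finset.sum_sub_distrib, Finset.sum_const, Finset.card_univ, Fintype.card_fin,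
      ← Nat.cast_smul_eq_nsmul ℝ, smul_sub, smul_smul, one_div_mul_cancel hN'.ne', one_smul]
    rfl
  rw [e2] at hj
  have e3 : inner ℝ (nodeAverage (fun i => gradient (r.lossOf i) (X i))) (c - Xs)
      = 1 / (N : ℝ) * ∑ i, inner ℝ (gradient (r.lossOf i) (X i)) (c - Xs) := by
    rw [nodeAverage, real_inner_smul_left, sum_inner]
  rw [e3]
  simp only [Finset.sum_sub_distrib, Finset.sum_add_distrib, ← Finset.mul_sum] at hsum
  have h4 := mul_le_mul_of_nonneg_left hj (div_nonneg hmu zero_le_two)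
  unfold loss
  linarith

lemma Assumptions.norm_average_gradient_sq_le (h : r.Assumptions L sigma zeta rho delta)
    (hL : 0 < L) {Xs : Params p q} (hXs : IsMinimizer r.loss Xs) (X : Fin N → Params p q) :
    ‖nodeAverage (fun i => gradient (r.lossOf i) (X i))‖ ^ 2
      ≤ 4 * L * (r.loss (nodeAverage X) - r.loss Xs)
        + 2 * L ^ 2 * (1 / (N : ℝ) * ∑ i, ‖nodeDeviation X i‖ ^ 2) := by
  have h1 := h.norm_average_gradient_sub_sq_le X
  have h2 := h.smooth_loss.norm_gradient_sq_le hL hXs (nodeAverage X)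
  have h3 := norm_add_sq_le_two_mul
    (nodeAverage (fun i => gradient (r.lossOf i) (X i)) - gradient r.loss (nodeAverage X))
    (gradient r.loss (nodeAverage X))
  rw [sub_add_cancel] at h3
  linarith

/-- Polarization writes the product of the true and the averaged gradient through their difference,
which the consensus distance controls. The term in `‖g‖²` so gained absorbs the second-order term
because `L * e ≤ 1`. The part linear in the noise is kept apart, to vanish in expectation. -/
lemma Assumptions.loss_step_le (h : r.Assumptions L sigma zeta rho delta) {e : ℝ} (he : 0 < e)
    (hLe : L * e ≤ 1) (X : Fin N → Params p q) (n : Params p q) :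
    r.loss (nodeAverage X - e • (nodeAverage (fun i => gradient (r.lossOf i) (X i)) + n))
      ≤ r.loss (nodeAverage X) - e / 2 * ‖gradient r.loss (nodeAverage X)‖ ^ 2
        + e / 2 * L ^ 2 * (1 / (N : ℝ) * ∑ i, ‖nodeDeviation X i‖ ^ 2) + L * e ^ 2 / 2 * ‖n‖ ^ 2
        + inner ℝ ((-e) • gradient r.loss (nodeAverage X)
          + (L * e ^ 2) • nodeAverage (fun i => gradient (r.lossOf i) (X i))) n := by
  have hdist := h.norm_average_gradient_sub_sq_le X
  set x := nodeAverage X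
  set g := nodeAverage fun i => gradient (r.lossOf i) (X i)
  have hd := h.smooth_loss.le_quadratic x (x - e • (g + n))
  set G := gradient r.loss x
  rw [sub_sub_cancel_left, inner_neg_right, inner_smul_right, norm_neg, norm_smul, mul_pow,
    Real.norm_eq_abs, sq_abs, norm_add_sq_real, inner_add_right] at hd
  rw [inner_add_left, real_inner_smul_left, real_inner_smul_left]
  rw [norm_sub_sq_real, real_inner_comm] at hdist
  have h1 := mul_le_mul_of_nonneg_left hdist (half_pos he).le
  have h2 : L / 2 * e ^ 2 * ‖g‖ ^ 2 ≤ e / 2 * ‖g‖ ^ 2 := by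
    have := mul_le_mul_of_nonneg_right hLe (by positivity : 0 ≤ e / 2 * ‖g‖ ^ 2)
    linarith
  linarith

/-- The inner product yields a decrease of 2e times the suboptimality; since `4 * L * e ≤ 1`, the
squared averaged gradient takes back at most one half of it. -/
lemma Assumptions.dist_step_le (h : r.Assumptions L sigma zeta rho delta) (hL : 0 < L)
    {mu : ℝ} (hmu : 0 ≤ mu) (hconv : ∀ i, IsMuConvex mu r.loss (r.lossOf i)) {Xs : Params p q}
    (hXs : IsMinimizer r.loss Xs) {e : ℝ} (he : 0 < e) (hLe : 4 * L * e ≤ 1)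
    (X : Fin N → Params p q) (n : Params p q) :
    ‖nodeAverage X - e • (nodeAverage (fun i => gradient (r.lossOf i) (X i)) + n) - Xs‖ ^ 2
      ≤ (1 - e * mu) * ‖nodeAverage X - Xs‖ ^ 2 - e * (r.loss (nodeAverage X) - r.loss Xs)
        + 2 * e * L * (1 / (N : ℝ) * ∑ i, ‖nodeDeviation X i‖ ^ 2) + e ^ 2 * ‖n‖ ^ 2
        + inner ℝ ((-2 * e) • (nodeAverage X - Xs)
          + (2 * e ^ 2) • nodeAverage (fun i => gradient (r.lossOf i) (X i))) n := by
  have h1 := h.inner_average_gradient_ge hmu hconv hXs X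
  have h2 := h.norm_average_gradient_sq_le hL hXs X
  have h3 : 0 ≤ 1 / (N : ℝ) * ∑ i, ‖nodeDeviation X i‖ ^ 2 := by positivity
  set x := nodeAverage X
  set g := nodeAverage fun i => gradient (r.lossOf i) (X i)
  set K := 1 / (N : ℝ) * ∑ i, ‖nodeDeviation X i‖ ^ 2
  have h4 : 0 ≤ r.loss x - r.loss Xs := sub_nonneg.2 (hXs x)
  have e1 : x - e • (g + n) - Xs = (x - Xs) - e • (g + n) := by abel
  rw [e1, norm_sub_sq_real, inner_smul_right, norm_smul, mul_pow, Real.norm_eq_abs, sq_abs,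
    norm_add_sq_real, inner_add_right, inner_add_left, real_inner_smul_left,
    real_inner_smul_left, real_inner_comm g (x - Xs)]
  have h5 := mul_le_mul_of_nonneg_left h1 (by positivity : 0 ≤ 2 * e)
  have h6 := mul_le_mul_of_nonneg_left h2 (by positivity : 0 ≤ e ^ 2)
  have h7 := mul_le_mul_of_nonneg_right hLe (mul_nonneg he.le h4)
  have h8 := mul_le_mul_of_nonneg_right hLe (by positivity : 0 ≤ e * L * K)
  have h9 : 0 ≤ e * L * K := by positivity
  linarith

end Deterministic

/-! ### The one-step inequalities in expectation -/

section Expectation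

/-- The mean squared distance of the models of round `t` from their mean. -/
def consensusDist (r : Run N p q Ξ Ω) (eta : ℕ → ℝ) (t : ℕ) (ω : Ω) : ℝ :=
  1 / (N : ℝ) * ∑ i, ‖nodeDeviation (r.iterate eta ω t) i‖ ^ 2

/-- The mean of the models of round `t`. -/
def meanModel (r : Run N p q Ξ Ω) (eta : ℕ → ℝ) (t : ℕ) (ω : Ω) : Params p q :=
  nodeAverage (r.iterate eta ω t)

lemma Assumptions.integrable_consensusDist (h : r.Assumptions L sigma zeta rho delta) (t : ℕ) :
    Integrable (r.consensusDist eta t) r.P :=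
  (integrable_finsetSum _ fun i _ =>
    (memLp_nodeDeviation (fun i => h.memLp_iterate t i) i).integrable_sq_norm).const_mul _

lemma Assumptions.memLp_meanModel (h : r.Assumptions L sigma zeta rho delta) (t : ℕ) :
    MemLp (r.meanModel eta t) 2 r.P :=
  memLp_nodeAverage fun i => h.memLp_iterate t i

lemma continuous_nodeAverage :
    Continuous (nodeAverage : (Fin N → Params p q) → Params p q) := by
  unfold nodeAverage
  fun_prop

lemma Assumptions.measurable_meanModel (h : r.Assumptions L sigma zeta rho delta) (t : ℕ) :
    Measurable (r.meanModel eta t) :=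
  continuous_nodeAverage.measurable.comp (h.measurable_models t)

lemma Assumptions.measurable_average_gradient (h : r.Assumptions L sigma zeta rho delta) :
    Measurable fun X : Fin N → Params p q => nodeAverage fun i => gradient (r.lossOf i) (X i) := by
  refine continuous_nodeAverage.measurable.comp (measurable_pi_lambda _ fun i => ?_)
  exact (h.smooth i).continuous_gradient.measurable.comp (measurable_pi_apply i)

lemma Assumptions.integrable_loss (h : r.Assumptions L sigma zeta rho delta) (t : ℕ) :
    Integrable (fun ω => r.loss (r.meanModel eta t ω)) r.P := by
  have := h.prob
  have hx := h.memLp_meanModel (eta := eta) t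
  have hdom := ((integrable_const (μ := r.P) |r.loss 0|).add
    ((hx.integrable one_le_two).norm.const_mul ‖gradient r.loss 0‖)).add
    (hx.integrable_sq_norm.const_mul (|L| / 2))
  refine hdom.mono'
    (h.smooth_loss.differentiable.continuous.comp_aestronglyMeasurable hx.1)
    (Filter.Eventually.of_forall fun ω => ?_)
  exact h.smooth_loss.abs_le_quadratic _

lemma Assumptions.integrable_norm_gradient_sq (h : r.Assumptions L sigma zeta rho delta) (t : ℕ) :
    Integrable (fun ω => ‖gradient r.loss (r.meanModel eta t ω)‖ ^ 2) r.P :=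
  have := h.prob
  (IsSmoothLoss.memLp_gradient h.smooth_loss (h.memLp_meanModel t)).integrable_sq_norm

/-- If a function of the mean model grows pathwise by at most a drift, a multiple of the squared
mean noise and a linear term in the mean noise, then so it does in expectation, without the
linear term. -/
lemma Assumptions.integral_succ_le_of_pathwise (h : r.Assumptions L sigma zeta rho delta) (t : ℕ)
    {u v : Ω → ℝ} {k : ℝ} (hk : 0 ≤ k) {H : (Fin N → Params p q) → Params p q}
    (hu : Integrable u r.P) (hv : Integrable v r.P) (hH : Measurable H)
    (hH2 : MemLp (fun ω => H (r.iterate eta ω t)) 2 r.P)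
    (hle : ∀ᵐ ω ∂r.P, u ω ≤ v ω + k * ‖nodeAverage (r.noise eta t ω)‖ ^ 2
      + inner ℝ (H (r.iterate eta ω t)) (nodeAverage (r.noise eta t ω))) :
    ∫ ω, u ω ∂r.P ≤ ∫ ω, v ω ∂r.P + k * (sigma ^ 2 / N) := by
  have hn : MemLp (fun ω => nodeAverage (r.noise eta t ω)) 2 r.P :=
    memLp_nodeAverage fun i => h.memLp_noise t i
  have hB := hn.integrable_sq_norm.const_mul k
  have hC := hH2.integrable_real_inner hn
  have hAB : Integrable (fun ω => v ω + k * ‖nodeAverage (r.noise eta t ω)‖ ^ 2) r.P := hv.add hB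
  have h1 := integral_mono_ae hu (hAB.add hC) hle
  have h2 : ∫ ω, (v ω + k * ‖nodeAverage (r.noise eta t ω)‖ ^ 2
      + inner ℝ (H (r.iterate eta ω t)) (nodeAverage (r.noise eta t ω))) ∂r.P
      = ∫ ω, v ω ∂r.P + k * ∫ ω, ‖nodeAverage (r.noise eta t ω)‖ ^ 2 ∂r.P := by
    rw [integral_add hAB hC, integral_add hv hB, h.integral_inner_average_noise t hH hH2,
      integral_const_mul, add_zero]
  have h3 := mul_le_mul_of_nonneg_left (h.integral_norm_average_noise_sq_le (eta := eta) t) hk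
  exact h1.trans (h2.le.trans (by linarith))

lemma Assumptions.integral_loss_succ_le (h : r.Assumptions L sigma zeta rho delta) (hL : 0 ≤ L)
    {e : ℝ} (he : 0 < e) (hLe : L * e ≤ 1) (t : ℕ) :
    ∫ ω, r.loss (r.meanModel (fun _ => e) (t + 1) ω) ∂r.P
      ≤ ∫ ω, r.loss (r.meanModel (fun _ => e) t ω) ∂r.P
        - e / 2 * ∫ ω, ‖gradient r.loss (r.meanModel (fun _ => e) t ω)‖ ^ 2 ∂r.P
        + e / 2 * (L ^ 2 * ∫ ω, r.consensusDist (fun _ => e) t ω ∂r.P + L * e * (sigma ^ 2 / N)) := by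
  have := h.prob
  have hf := h.integrable_loss (eta := fun _ => e) t
  have hg := (h.integrable_norm_gradient_sq (eta := fun _ => e) t).const_mul (e / 2)
  have hX := (h.integrable_consensusDist (eta := fun _ => e) t).const_mul (e / 2 * L ^ 2)
  have hfg : Integrable (fun ω => r.loss (r.meanModel (fun _ => e) t ω)
      - e / 2 * ‖gradient r.loss (r.meanModel (fun _ => e) t ω)‖ ^ 2) r.P := hf.sub hg
  set H : (Fin N → Params p q) → Params p q := fun X => (-e) • gradient r.loss (nodeAverage X)
    + (L * e ^ 2) • nodeAverage fun i => gradient (r.lossOf i) (X i) with hH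
  have hH1 : Measurable H :=
    ((h.smooth_loss.continuous_gradient.measurable.comp
      continuous_nodeAverage.measurable).const_smul (-e)).add
      (h.measurable_average_gradient.const_smul (L * e ^ 2))
  have hH2 : MemLp (fun ω => H (r.iterate (fun _ => e) ω t)) 2 r.P :=
    ((IsSmoothLoss.memLp_gradient h.smooth_loss
      (h.memLp_meanModel (eta := fun _ => e) t)).const_smul (-e)).add
      ((memLp_nodeAverage fun i => h.memLp_localGradient (eta := fun _ => e) t i).const_smul
        (L * e ^ 2))
  have hpath : ∀ᵐ ω ∂r.P, r.loss (r.meanModel (fun _ => e) (t + 1) ω)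
      ≤ (r.loss (r.meanModel (fun _ => e) t ω)
        - e / 2 * ‖gradient r.loss (r.meanModel (fun _ => e) t ω)‖ ^ 2
        + e / 2 * L ^ 2 * r.consensusDist (fun _ => e) t ω)
        + L * e ^ 2 / 2 * ‖nodeAverage (r.noise (fun _ => e) t ω)‖ ^ 2
        + inner ℝ (H (r.iterate (fun _ => e) ω t)) (nodeAverage (r.noise (fun _ => e) t ω)) := by
    filter_upwards [h.ae_nodeAverage_succ (eta := fun _ => e) t] with ω hω
    have := h.loss_step_le he hLe (r.iterate (fun _ => e) ω t)
      (nodeAverage (r.noise (fun _ => e) t ω))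
    rw [meanModel, hω]
    exact this
  have key := h.integral_succ_le_of_pathwise t (by positivity : 0 ≤ L * e ^ 2 / 2)
    (h.integrable_loss (t + 1)) (hfg.add hX) hH1 hH2 hpath
  have e1 : ∫ ω, (r.loss (r.meanModel (fun _ => e) t ω)
      - e / 2 * ‖gradient r.loss (r.meanModel (fun _ => e) t ω)‖ ^ 2
      + e / 2 * L ^ 2 * r.consensusDist (fun _ => e) t ω) ∂r.P
      = ∫ ω, r.loss (r.meanModel (fun _ => e) t ω) ∂r.P
        - e / 2 * ∫ ω, ‖gradient r.loss (r.meanModel (fun _ => e) t ω)‖ ^ 2 ∂r.P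
        + e / 2 * L ^ 2 * ∫ ω, r.consensusDist (fun _ => e) t ω ∂r.P := by
    rw [integral_add hfg hX, integral_sub hf hg, integral_const_mul, integral_const_mul]
  refine key.trans ((add_le_add_left e1.le _).trans ?_)
  linarith

lemma Assumptions.integral_dist_succ_le (h : r.Assumptions L sigma zeta rho delta) (hL : 0 < L)
    {mu : ℝ} (hmu : 0 ≤ mu) (hconv : ∀ i, IsMuConvex mu r.loss (r.lossOf i)) {Xs : Params p q}
    (hXs : IsMinimizer r.loss Xs) {e : ℝ} (he : 0 < e) (hLe : 4 * L * e ≤ 1) (t : ℕ) :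
    ∫ ω, ‖r.meanModel (fun _ => e) (t + 1) ω - Xs‖ ^ 2 ∂r.P
      ≤ (1 - e * mu) * ∫ ω, ‖r.meanModel (fun _ => e) t ω - Xs‖ ^ 2 ∂r.P
        - e * (∫ ω, (r.loss (r.meanModel (fun _ => e) t ω) - r.loss Xs) ∂r.P
          - (2 * L * ∫ ω, r.consensusDist (fun _ => e) t ω ∂r.P + e * (sigma ^ 2 / N))) := by
  have := h.prob
  have hx : ∀ t, MemLp (fun ω => r.meanModel (fun _ => e) t ω - Xs) 2 r.P := fun t =>
    (h.memLp_meanModel (eta := fun _ => e) t).sub (memLp_const Xs)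
  have hD := (hx t).integrable_sq_norm.const_mul (1 - e * mu)
  have hf : Integrable (fun ω => e * (r.loss (r.meanModel (fun _ => e) t ω) - r.loss Xs)) r.P :=
    ((h.integrable_loss (eta := fun _ => e) t).sub (integrable_const _)).const_mul _
  have hX := (h.integrable_consensusDist (eta := fun _ => e) t).const_mul (2 * e * L)
  have hDf : Integrable (fun ω => (1 - e * mu) * ‖r.meanModel (fun _ => e) t ω - Xs‖ ^ 2
      - e * (r.loss (r.meanModel (fun _ => e) t ω) - r.loss Xs)) r.P := hD.sub hf
  set H : (Fin N → Params p q) → Params p q := fun X => (-2 * e) • (nodeAverage X - Xs)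
    + (2 * e ^ 2) • nodeAverage fun i => gradient (r.lossOf i) (X i) with hH
  have hH1 : Measurable H :=
    ((continuous_nodeAverage.measurable.sub_const Xs).const_smul (-2 * e)).add
      (h.measurable_average_gradient.const_smul (2 * e ^ 2))
  have hH2 : MemLp (fun ω => H (r.iterate (fun _ => e) ω t)) 2 r.P :=
    ((hx t).const_smul (-2 * e)).add
      ((memLp_nodeAverage fun i => h.memLp_localGradient (eta := fun _ => e) t i).const_smul
        (2 * e ^ 2))
  have hpath : ∀ᵐ ω ∂r.P, ‖r.meanModel (fun _ => e) (t + 1) ω - Xs‖ ^ 2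
      ≤ ((1 - e * mu) * ‖r.meanModel (fun _ => e) t ω - Xs‖ ^ 2
        - e * (r.loss (r.meanModel (fun _ => e) t ω) - r.loss Xs)
        + 2 * e * L * r.consensusDist (fun _ => e) t ω)
        + e ^ 2 * ‖nodeAverage (r.noise (fun _ => e) t ω)‖ ^ 2
        + inner ℝ (H (r.iterate (fun _ => e) ω t)) (nodeAverage (r.noise (fun _ => e) t ω)) := by
    filter_upwards [h.ae_nodeAverage_succ (eta := fun _ => e) t] with ω hω
    have := h.dist_step_le hL hmu hconv hXs he hLe (r.iterate (fun _ => e) ω t)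
      (nodeAverage (r.noise (fun _ => e) t ω))
    rw [meanModel, hω]
    exact this
  have key := h.integral_succ_le_of_pathwise t (sq_nonneg e) (hx (t + 1)).integrable_sq_norm
    (hDf.add hX) hH1 hH2 hpath
  have e1 : ∫ ω, ((1 - e * mu) * ‖r.meanModel (fun _ => e) t ω - Xs‖ ^ 2
      - e * (r.loss (r.meanModel (fun _ => e) t ω) - r.loss Xs)
      + 2 * e * L * r.consensusDist (fun _ => e) t ω) ∂r.P
      = (1 - e * mu) * ∫ ω, ‖r.meanModel (fun _ => e) t ω - Xs‖ ^ 2 ∂r.P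
        - e * ∫ ω, (r.loss (r.meanModel (fun _ => e) t ω) - r.loss Xs) ∂r.P
        + 2 * e * L * ∫ ω, r.consensusDist (fun _ => e) t ω ∂r.P := by
    rw [integral_add hDf hX, integral_sub hD hf, integral_const_mul, integral_const_mul,
      integral_const_mul]
  refine key.trans ((add_le_add_left e1.le _).trans ?_)
  linarith

end Expectation

end Run

/-! ### The output and the complexity bounds -/

namespace Run

variable {N p q : ℕ} {Ξ Ω : Type*} [MeasurableSpace Ξ] [mΩ : MeasurableSpace Ω]
  {r : Run N p q Ξ Ω} {L sigma zeta rho delta : ℝ} {eta : ℕ → ℝ}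

section Output

/-- The output time has a finite sum of point masses as its law, so Fubini reduces the expectation
at the output to a weighted average of expectations at fixed times. -/
lemma Assumptions.outputAccurate (h : r.Assumptions L sigma zeta rho delta) {alpha : ℕ → ℝ}
    (halpha : ∀ t, 0 < alpha t) {T : ℕ} {phi : Params p q → ℝ} (hphi : Continuous phi) {eps : ℝ}
    (hint : ∀ t, Integrable (fun ω => phi (r.meanModel eta t ω)) r.P)
    (hle : ∑ t ∈ Finset.range (T + 1), alpha t * ∫ ω, phi (r.meanModel eta t ω) ∂r.P
      ≤ eps * ∑ t ∈ Finset.range (T + 1), alpha t) :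
    r.OutputAccurate eta alpha T phi eps := by
  have := h.prob
  set total := ∑ t ∈ Finset.range (T + 1), alpha t with htotal
  have hpos : 0 < total := Finset.sum_pos (fun t _ => halpha t) ⟨0, by simp⟩
  set law : Measure ℕ :=
    ∑ t ∈ Finset.range (T + 1), ENNReal.ofReal (alpha t / total) • Measure.dirac t with hlaw
  have hfin : IsFiniteMeasure law := by
    refine ⟨?_⟩
    rw [hlaw, Measure.finsetSum_apply]
    exact ENNReal.sum_lt_top.2 fun t _ => by simp
  have hmeas : Measurable (fun z : Ω × ℕ => phi (r.output eta z)) :=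
    measurable_from_prod_countable_left fun t =>
      hphi.measurable.comp (h.measurable_meanModel t)
  have hdirac : ∀ g : ℕ → ℝ, ∀ t ∈ Finset.range (T + 1),
      Integrable g (ENNReal.ofReal (alpha t / total) • Measure.dirac t) := fun g t _ =>
    (integrable_dirac (by simp)).smul_measure ENNReal.ofReal_ne_top
  have hlawint : ∀ g : ℕ → ℝ, Integrable g law := fun g =>
    integrable_finsetSum_measure.2 (hdirac g)
  have hI : Integrable (fun z : Ω × ℕ => phi (r.output eta z)) (r.P.prod law) :=
    (integrable_prod_iff' hmeas.aestronglyMeasurable).2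
      ⟨Filter.Eventually.of_forall hint, hlawint _⟩
  refine ⟨hpos, hI, ?_⟩
  rw [integral_prod_symm _ hI, hlaw, integral_finsetSum_measure (hdirac _)]
  have e : ∀ t ∈ Finset.range (T + 1),
      ∫ s, (∫ ω, phi (r.output eta (ω, s)) ∂r.P)
        ∂(ENNReal.ofReal (alpha t / total) • Measure.dirac t)
      = alpha t * (∫ ω, phi (r.meanModel eta t ω) ∂r.P) / total := by
    intro t _
    rw [integral_smul_measure, integral_dirac,
      ENNReal.toReal_ofReal (div_nonneg (halpha t).le hpos.le), smul_eq_mul, mul_comm_div, ← mul_div_assoc]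
    rfl
  rw [Finset.sum_congr rfl e, ← Finset.sum_div, div_le_iff₀ hpos]
  exact hle

lemma Assumptions.outputAccurate_of_forall_eq_zero (h : r.Assumptions L sigma zeta rho delta)
    {alpha : ℕ → ℝ} (halpha : ∀ t, 0 < alpha t) {T : ℕ} {phi : Params p q → ℝ}
    (hphi : ∀ x, phi x = 0) {eps : ℝ} (heps : 0 ≤ eps) :
    r.OutputAccurate eta alpha T phi eps := by
  obtain rfl : phi = fun _ => 0 := funext hphi
  refine h.outputAccurate halpha continuous_const (fun t => integrable_zero _ _ _) ?_
  simp only [integral_zero, mul_zero, Finset.sum_const_zero]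
  exact mul_nonneg heps (Finset.sum_nonneg fun t _ => (halpha t).le)

end Output

/-! ### A priori bounds on ρ, δ and μ -/

section Parameters

/-- Both facts come from testing the spectral gap on the difference of two coordinate vectors:
without edges W would be the identity, which has no gap, and ρ > 1 would make a sum of squares
negative. The edge is needed because only compressors on edges bound δ. -/
lemma Assumptions.exists_adj_and_rho_le_one (h : r.Assumptions L sigma zeta rho delta) :
    (∃ i j, r.G.Adj i j) ∧ rho ≤ 1 := by
  have hN := h.one_lt
  set y : Fin N → ℝ := Pi.single ⟨0, by omega⟩ 1 - Pi.single ⟨1, hN⟩ 1 with hy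
  have hy0 : ∑ i, y i = 0 := by simp [hy]
  have hpos : 0 < ∑ i, y i ^ 2 := by
    refine Finset.sum_pos' (fun i _ => sq_nonneg _) ⟨⟨0, by omega⟩, Finset.mem_univ _, ?_⟩
    simp [hy]
  have hle := h.mixing.gap.sum_sq_mulVec_le h.mixing.gap_pos h.mixing.symm
    h.mixing.doubly_stochastic hy0
  constructor
  · by_contra! hno
    have hoff : ∀ i j, i ≠ j → r.W i j = 0 := fun i j hij => by
      by_contra hW
      exact (h.mixing.support i j hW).elim hij (hno i j)
    have hdiag : ∀ i, r.W i i = 1 := fun i => by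
      rw [← sum_row_of_mem_doublyStochastic h.mixing.doubly_stochastic i]
      exact (Finset.sum_eq_single i (fun j _ hj => hoff i j hj.symm) (by simp)).symm
    have hmul : ∀ i, ∑ j, r.W i j * y j = y i := fun i => by
      rw [Finset.sum_eq_single i (fun j _ hj => by rw [hoff i j hj.symm, zero_mul]) (by simp),
        hdiag, one_mul]
    simp only [hmul] at hle
    nlinarith [h.mixing.gap_pos]
  · by_contra! hrho
    have h0 : 0 ≤ ∑ i, (∑ j, r.W i j * y j) ^ 2 := Finset.sum_nonneg fun i _ => sq_nonneg _
    nlinarith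

/-- A projection satisfies ⟨x, Cx⟩ ≤ ‖x‖², and the left side has mean δ‖x‖²; a nonzero x is
required. -/
lemma Assumptions.delta_le_one (h : r.Assumptions L sigma zeta rho delta)
    [Nontrivial (Params p q)] : delta ≤ 1 := by
  have := h.prob
  obtain ⟨i, j, hij⟩ := h.exists_adj_and_rho_le_one.1
  obtain ⟨x, hx⟩ := exists_ne (0 : Params p q)
  have key := integral_inner_apply_eq
    (sup_le (h.history_le 0) (samplesOf_le h.samples 0)) (h.compressors.measurable 0 i j)
    (h.compressors.projection 0 i j hij) (h.compressors.unbiased 0 i j hij)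
    (h := fun _ => x) (Z := fun _ => x) measurable_const measurable_const (memLp_const x)
    (memLp_const x)
  have hle : ∫ ω, (inner ℝ x (r.comp 0 i j ω x) : ℝ) ∂r.P ≤ ∫ _ : Ω, ‖x‖ ^ 2 ∂r.P := by
    refine integral_mono_ae ?_ (integrable_const _) ?_
    · exact (memLp_const x).integrable_real_inner
        (h.memLp_comp_apply hij measurable_const (memLp_const x))
    · filter_upwards [h.compressors.projection 0 i j hij] with ω hω
      rw [← hω.norm_apply_sq]
      exact pow_le_pow_left₀ (norm_nonneg _) (hω.norm_apply_le x) 2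
  rw [key] at hle
  simp only [real_inner_self_eq_norm_sq, integral_const, probReal_univ, one_smul] at hle
  have hx2 : 0 < ‖x‖ ^ 2 := by positivity
  by_contra! hd
  nlinarith

lemma Assumptions.rho_mul_delta_le_one (h : r.Assumptions L sigma zeta rho delta)
    (hdelta : 0 < delta) [Nontrivial (Params p q)] : rho * delta ≤ 1 :=
  mul_le_one₀ h.exists_adj_and_rho_le_one.2 hdelta.le h.delta_le_one

/-- At any point x other than the minimizer, convexity bounds ⟨∇f(x), x - X*⟩ below by μ/2 ‖x -
X*‖², and the Lipschitz gradient, which vanishes at X*, bounds it above by L‖x - X*‖². -/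
lemma Assumptions.mu_le (h : r.Assumptions L sigma zeta rho delta) {mu : ℝ}
    (hmu : 0 ≤ mu) (hconv : ∀ i, IsMuConvex mu r.loss (r.lossOf i)) (hL : 0 < L) {Xs : Params p q}
    (hXs : IsMinimizer r.loss Xs) [Nontrivial (Params p q)] : mu ≤ 2 * L := by
  have hN : (N : ℝ) ≠ 0 := by exact_mod_cast (zero_lt_one.trans h.one_lt).ne'
  obtain ⟨x, hx⟩ := exists_ne Xs
  have hc : nodeAverage (fun _ : Fin N => x) = x := by
    rw [nodeAverage, Finset.sum_const, Finset.card_univ, Fintype.card_fin,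
      ← Nat.cast_smul_eq_nsmul ℝ, smul_smul, one_div_mul_cancel hN, one_smul]
  have h1 := h.inner_average_gradient_ge hmu hconv hXs (fun _ => x)
  have hg : nodeAverage (fun i => gradient (r.lossOf i) x) = gradient r.loss x := by
    rw [h.gradient_loss]; rfl
  simp only [nodeDeviation, hc, hg, sub_self, norm_zero] at h1
  have h2 := hXs x
  have h3 := h.smooth_loss.norm_gradient_sq_le hL hXs Xs
  have h4 : gradient r.loss Xs = 0 := by
    rw [sub_self, mul_zero] at h3
    exact norm_eq_zero.1 (by nlinarith [norm_nonneg (gradient r.loss Xs)])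
  have h5 := h.smooth_loss.lipschitz_grad x Xs
  rw [h4, sub_zero] at h5
  have h6 := real_inner_le_norm (gradient r.loss x) (x - Xs)
  have hpos : 0 < ‖x - Xs‖ := norm_pos_iff.2 (sub_ne_zero.2 hx)
  have h7 := mul_le_mul_of_nonneg_right h5 hpos.le
  simp only [ne_eq, OfNat.ofNat_ne_zero, not_false_eq_true, zero_pow, Finset.sum_const_zero, mul_zero,
    sub_zero] at h1
  by_contra! hlt
  nlinarith [mul_pos hpos hpos]

end Parameters

/-! ### Non-convex case: telescoping the loss -/

section Nonconvex

/-- The accuracy is shared evenly: `hbias` allows ε/2 for noise and consensus error, `hT` allows ε/2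
for the initial gap. -/
lemma Assumptions.nonconvex_outputAccurate (h : r.Assumptions L sigma zeta rho delta) (hL : 0 < L)
    (hsigma : 0 ≤ sigma) (hzeta : 0 ≤ zeta) (hdelta : 0 < delta) (ha : rho * delta ≤ 1)
    {Delta0 : ℝ} (hDelta : ∀ Y, r.loss r.X0 - r.loss Y ≤ Delta0) {e eps : ℝ} (he : 0 < e)
    (hstep : 32 * L * e ≤ rho * delta)
    (hbias : L ^ 2 * (192 * (e * (zeta + sigma) / (rho * delta)) ^ 2) + L * e * (sigma ^ 2 / N)
      ≤ eps / 2) {T : ℕ} (hT : 2 * Delta0 ≤ eps / 2 * (e * (T + 1))) :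
    r.OutputAccurate (fun _ => e) (fun _ => 1) T (fun X => ‖gradient r.loss X‖ ^ 2) eps := by
  have := h.prob
  have hN : (N : ℝ) ≠ 0 := by exact_mod_cast (zero_lt_one.trans h.one_lt).ne'
  refine h.outputAccurate (fun _ => one_pos) (h.smooth_loss.continuous_gradient.norm.pow 2)
    (fun t => h.integrable_norm_gradient_sq t) ?_
  set f : ℕ → ℝ := fun t => ∫ ω, r.loss (r.meanModel (fun _ => e) t ω) ∂r.P with hf
  set g : ℕ → ℝ := fun t => ∫ ω, ‖gradient r.loss (r.meanModel (fun _ => e) t ω)‖ ^ 2 ∂r.P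
  have hrec : ∀ t, f (t + 1) ≤ f t - e / 2 * g t + e / 2 * (eps / 2) := fun t => by
    have h1 := h.integral_loss_succ_le hL.le he (by linarith) t
    have h2 := h.integral_consensus_le hL.le hsigma hzeta hdelta ha he hstep t
    have h3 := mul_le_mul_of_nonneg_left h2 (sq_nonneg L)
    have h4 := mul_le_mul_of_nonneg_left ((add_le_add_left h3 _).trans hbias) (half_pos he).le
    exact h1.trans (by unfold consensusDist; linarith)
  have hsum : ∀ n, e / 2 * ∑ t ∈ Finset.range n, g t ≤ f 0 - f n + n * (e / 2 * (eps / 2)) := by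
    intro n
    induction n with
    | zero => simp
    | succ n ih =>
      rw [Finset.sum_range_succ, mul_add]
      push_cast
      linarith [hrec n]
  have hf0 : f 0 = r.loss r.X0 := by
    have : ∀ ω, r.meanModel (fun _ => e) 0 ω = r.X0 := fun ω => by
      simp only [meanModel, iterate, nodeAverage]
      rw [Finset.sum_const, Finset.card_univ, Fintype.card_fin,
        ← Nat.cast_smul_eq_nsmul ℝ, smul_smul, one_div_mul_cancel hN, one_smul]
    simp [hf, this]
  have hfT : r.loss r.X0 - Delta0 ≤ f (T + 1) := by
    have : ∫ _ : Ω, (r.loss r.X0 - Delta0) ∂r.P ≤ f (T + 1) :=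
      integral_mono (integrable_const _) (h.integrable_loss (T + 1)) fun ω => by
        linarith [hDelta (r.meanModel (fun _ => e) (T + 1) ω)]
    simpa using this
  have h5 := hsum (T + 1)
  push_cast at h5
  simp only [one_mul, Finset.sum_const, Finset.card_range, nsmul_eq_mul, mul_one]
  push_cast
  have h6 : e / 2 * ∑ t ∈ Finset.range (T + 1), g t ≤ e / 2 * (eps * (T + 1)) := by linarith
  exact le_of_mul_le_mul_left h6 (half_pos he)

end Nonconvex

/-! ### Convex cases: telescoping the distance to a minimizer -/

section Convex

/-- Since (1 + x)(1 - x) ≤ 1, the weights undo the contraction and the sum telescopes. Weights with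
powers of 1/(1 - x) would need x < 1; for x = 0 this is the unweighted sum. -/
lemma weighted_sum_le_of_contraction {D F : ℕ → ℝ} {x e B : ℝ} (hx : 0 ≤ x) (hD : ∀ t, 0 ≤ D t)
    (hrec : ∀ t, D (t + 1) ≤ (1 - x) * D t - e * (F t - B)) (n : ℕ) :
    e * ∑ t ∈ Finset.range n, (1 + x) ^ (t + 1) * (F t - B) ≤ D 0 - (1 + x) ^ n * D n := by
  induction n with
  | zero => simp
  | succ n ih =>
    rw [Finset.sum_range_succ, mul_add]
    have h1 := mul_le_mul_of_nonneg_left (hrec n) (by positivity : 0 ≤ (1 + x) ^ (n + 1))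
    have h2 : 0 ≤ x ^ 2 * ((1 + x) ^ n * D n) :=
      mul_nonneg (sq_nonneg x) (mul_nonneg (by positivity) (hD n))
    have h3 : (1 + x) ^ (n + 1) * ((1 - x) * D n) = (1 + x) ^ n * D n - x ^ 2 * ((1 + x) ^ n * D n) := by
      ring
    linarith

lemma Assumptions.convex_outputAccurate (h : r.Assumptions L sigma zeta rho delta) (hL : 0 < L)
    (hsigma : 0 ≤ sigma) (hzeta : 0 ≤ zeta) (hdelta : 0 < delta) (ha : rho * delta ≤ 1)
    {mu R : ℝ} (hmu : 0 ≤ mu) (hconv : ∀ i, IsMuConvex mu r.loss (r.lossOf i)) {Xs : Params p q}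
    (hXs : IsMinimizer r.loss Xs) (hR : ‖r.X0 - Xs‖ ≤ R) {e eps : ℝ} (he : 0 < e)
    (hstep : 32 * L * e ≤ rho * delta)
    (hbias : 2 * L * (192 * (e * (zeta + sigma) / (rho * delta)) ^ 2) + e * (sigma ^ 2 / N)
      ≤ eps / 2) {T : ℕ}
    (hT : R ^ 2 ≤ eps / 2 * (e * ∑ t ∈ Finset.range (T + 1), (1 + e * mu) ^ (t + 1))) :
    r.OutputAccurate (fun _ => e) (fun t => (1 + e * mu) ^ (t + 1)) T
      (fun X => r.loss X - r.loss Xs) eps := by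
  have := h.prob
  have hN : (N : ℝ) ≠ 0 := by exact_mod_cast (zero_lt_one.trans h.one_lt).ne'
  have hx : 0 ≤ e * mu := mul_nonneg he.le hmu
  refine h.outputAccurate (fun _ => by positivity)
    (h.smooth_loss.differentiable.continuous.sub continuous_const)
    (fun t => (h.integrable_loss t).sub (integrable_const _)) ?_
  set D : ℕ → ℝ := fun t => ∫ ω, ‖r.meanModel (fun _ => e) t ω - Xs‖ ^ 2 ∂r.P with hD
  set F : ℕ → ℝ := fun t => ∫ ω, (r.loss (r.meanModel (fun _ => e) t ω) - r.loss Xs) ∂r.P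
  have hD0 : ∀ t, 0 ≤ D t := fun t => integral_nonneg fun ω => by positivity
  have hrec : ∀ t, D (t + 1) ≤ (1 - e * mu) * D t - e * (F t - eps / 2) := fun t => by
    have h1 := h.integral_dist_succ_le hL hmu hconv hXs he (by linarith [mul_pos hL he]) t
    have h2 := h.integral_consensus_le hL.le hsigma hzeta hdelta ha he hstep t
    have h3 := mul_le_mul_of_nonneg_left h2 (by positivity : 0 ≤ 2 * L)
    have h4 := mul_le_mul_of_nonneg_left ((add_le_add_left h3 _).trans hbias) he.le
    exact h1.trans (by unfold consensusDist; linarith)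
  have hsum := weighted_sum_le_of_contraction hx hD0 hrec (T + 1)
  have hinit : D 0 ≤ R ^ 2 := by
    have : ∀ ω, r.meanModel (fun _ => e) 0 ω = r.X0 := fun ω => by
      simp only [meanModel, iterate, nodeAverage]
      rw [Finset.sum_const, Finset.card_univ, Fintype.card_fin,
        ← Nat.cast_smul_eq_nsmul ℝ, smul_smul, one_div_mul_cancel hN, one_smul]
    simp only [hD, this, integral_const, probReal_univ, one_smul]
    exact pow_le_pow_left₀ (norm_nonneg _) hR 2
  have hlast : 0 ≤ (1 + e * mu) ^ (T + 1) * D (T + 1) :=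
    mul_nonneg (by positivity) (hD0 _)
  simp only [mul_sub, Finset.sum_sub_distrib, ← Finset.sum_mul] at hsum
  have h6 : e * ∑ t ∈ Finset.range (T + 1), (1 + e * mu) ^ (t + 1) * F t
      ≤ e * (eps * ∑ t ∈ Finset.range (T + 1), (1 + e * mu) ^ (t + 1)) := by linarith
  exact le_of_mul_le_mul_left h6 he

end Convex

end Run

/-! ### The choice of the stepsize -/

section Stepsize

lemma Real.rpow_three_halves {x : ℝ} (hx : 0 < x) : x ^ (3 / 2 : ℝ) = x * √x := by
  rw [Real.sqrt_eq_rpow, ← Real.rpow_one_add' hx.le (by norm_num)]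
  norm_num

/-- One stepsize meets three constraints at once. Only `C` has to be positive, as the noise and
heterogeneity terms may vanish. -/
lemma stepsize_mul_le {A B C : ℝ} (hA : 0 ≤ A) (hB : 0 ≤ B) (hC : 0 < C) :
    0 < 1 / (32 * (A + B + C)) ∧ 1 / (32 * (A + B + C)) * A ≤ 1 / 32
      ∧ 1 / (32 * (A + B + C)) * B ≤ 1 / 32 ∧ 1 / (32 * (A + B + C)) * C ≤ 1 / 32 := by
  have hS : 0 < A + B + C := by positivity
  refine ⟨by positivity, ?_, ?_, ?_⟩ <;>
  · rw [div_mul_eq_mul_div, div_le_div_iff₀ (by positivity) (by norm_num)]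
    linarith

/-- The noise costs ε/32 and the consensus error 192 ε/32² = 6ε/32, in total below ε/2. In the
convex analogue below, the consensus error counts twice and the total is 13ε/32. -/
lemma nonconvex_bias_le {L sigma zeta a n eps e : ℝ} (heps : 0 < eps) (he : 0 < e) (hL : 0 < L)
    (hsigma : 0 ≤ sigma) (hzeta : 0 ≤ zeta) (ha : 0 < a)
    (hA : e * (L * sigma ^ 2 / (n * eps)) ≤ 1 / 32)
    (hB : e * (L * (zeta + sigma) / (a * √eps)) ≤ 1 / 32) :
    L ^ 2 * (192 * (e * (zeta + sigma) / a) ^ 2) + L * e * (sigma ^ 2 / n) ≤ eps / 2 := by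
  have hs : 0 < √eps := Real.sqrt_pos.2 heps
  have h1 : L * e * (sigma ^ 2 / n) = e * (L * sigma ^ 2 / (n * eps)) * eps := by field_simp
  have h2 : L ^ 2 * (e * (zeta + sigma) / a) ^ 2
      = (e * (L * (zeta + sigma) / (a * √eps))) ^ 2 * eps := by
    rw [← Real.sq_sqrt heps.le, Real.sqrt_sq hs.le]
    field_simp
  have h3 := pow_le_pow_left₀ (by positivity) hB 2
  have h4 := mul_le_mul_of_nonneg_right h3 heps.le
  have h5 := mul_le_mul_of_nonneg_right hA heps.le
  rw [h1]
  linarith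

lemma convex_bias_le {L sigma zeta a n eps e : ℝ} (heps : 0 < eps) (he : 0 < e) (hL : 0 < L)
    (hsigma : 0 ≤ sigma) (hzeta : 0 ≤ zeta) (ha : 0 < a)
    (hA : e * (sigma ^ 2 / (n * eps)) ≤ 1 / 32)
    (hB : e * (√L * (zeta + sigma) / (a * √eps)) ≤ 1 / 32) :
    2 * L * (192 * (e * (zeta + sigma) / a) ^ 2) + e * (sigma ^ 2 / n) ≤ eps / 2 := by
  have hs : 0 < √eps := Real.sqrt_pos.2 heps
  have h1 : e * (sigma ^ 2 / n) = e * (sigma ^ 2 / (n * eps)) * eps := by field_simp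
  have h2 : L * (e * (zeta + sigma) / a) ^ 2
      = (e * (√L * (zeta + sigma) / (a * √eps))) ^ 2 * eps := by
    have e1 : (e * (√L * (zeta + sigma) / (a * √eps))) ^ 2
        = √L ^ 2 * (e * (zeta + sigma) / a) ^ 2 / √eps ^ 2 := by field_simp
    rw [e1, Real.sq_sqrt heps.le, Real.sq_sqrt hL.le, div_mul_cancel₀ _ heps.ne']
  have h3 := pow_le_pow_left₀ (by positivity) hB 2
  have h4 := mul_le_mul_of_nonneg_right h3 heps.le
  have h5 := mul_le_mul_of_nonneg_right hA heps.le
  rw [h1]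
  linarith

/-- Geometric weights: after a number of rounds logarithmic in `y` the total weight exceeds
`2 y / x`. -/
lemma le_sum_geometric_weights {x y : ℝ} (hx0 : 0 ≤ x) (hx1 : x ≤ 1) (hy : 0 ≤ y) {n : ℕ}
    (hn : 4 * Real.log (2 + y) ≤ n * x) :
    2 * y ≤ x * ∑ t ∈ Finset.range n, (1 + x) ^ (t + 1) := by
  have hlog : x / 2 ≤ Real.log (1 + x) := by
    have h1 : 1 - (1 + x)⁻¹ ≤ Real.log (1 + x) := Real.one_sub_inv_le_log_of_pos (by linarith)
    have h2 : x / 2 ≤ 1 - (1 + x)⁻¹ := by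
      have : 1 - (1 + x)⁻¹ = x / (1 + x) := by field_simp; ring
      rw [this]
      gcongr
      linarith
    linarith
  -- The geometric sum times x is (1 + x)^n - 1, so the square is more than enough: (2 + y)² - 1 ≥
  -- 2y. The exponent 2 is the 4 of the hypothesis times the 1/2 lost in `hlog`.
  have hpow : (2 + y) ^ 2 ≤ (1 + x) ^ n := by
    rw [← Real.log_le_log_iff (by positivity) (by positivity), Real.log_pow, Real.log_pow]
    have := mul_le_mul_of_nonneg_left hlog (Nat.cast_nonneg (α := ℝ) n)
    push_cast
    linarith
  have hgeom : x * ∑ t ∈ Finset.range n, (1 + x) ^ t = (1 + x) ^ n - 1 := by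
    have := mul_geom_sum (1 + x) n
    rwa [add_sub_cancel_left] at this
  have hle : ∑ t ∈ Finset.range n, (1 + x) ^ t ≤ ∑ t ∈ Finset.range n, (1 + x) ^ (t + 1) :=
    Finset.sum_le_sum fun t _ => pow_le_pow_right₀ (by linarith) t.le_succ
  have := mul_le_mul_of_nonneg_left hle hx0
  nlinarith

end Stepsize

/-! ### The degenerate case L = 0 and the complexity bounds -/

namespace Run

variable {N p q : ℕ} {Ξ Ω : Type*} [MeasurableSpace Ξ] [mΩ : MeasurableSpace Ω]
  {r : Run N p q Ξ Ω} {L sigma zeta rho delta : ℝ} {eta : ℕ → ℝ}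

section Degenerate

lemma Assumptions.gradient_loss_eq_zero (h : r.Assumptions 0 sigma zeta rho delta) {m : ℝ}
    (hm : ∀ z, m ≤ r.loss z) (x : Params p q) : gradient r.loss x = 0 :=
  h.smooth_loss.gradient_eq_zero hm x

lemma Assumptions.loss_eq_of_isMinimizer (h : r.Assumptions 0 sigma zeta rho delta)
    {Xs : Params p q} (hXs : IsMinimizer r.loss Xs) (x : Params p q) : r.loss x = r.loss Xs := by
  have h1 := h.smooth_loss.le_quadratic Xs x
  rw [h.gradient_loss_eq_zero hXs, inner_zero_left] at h1
  linarith [hXs x]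

end Degenerate

section Complexity

lemma Assumptions.nonconvex_complexity (h : r.Assumptions L sigma zeta rho delta) (hL : 0 < L)
    (hsigma : 0 ≤ sigma) (hzeta : 0 ≤ zeta) (hdelta : 0 < delta) {eps Delta0 : ℝ}
    (heps : 0 < eps) (hDelta : ∀ Y, r.loss r.X0 - r.loss Y ≤ Delta0) {T : ℕ}
    (hT : 128 * Delta0 * (L * sigma ^ 2 / (N * eps ^ 2)
      + L * (zeta + sigma) / (rho * delta * eps ^ (3 / 2 : ℝ)) + L / (rho * delta * eps)) ≤ T) :
    r.OutputAccurate (fun _ => 1 / (32 * (L * sigma ^ 2 / (N * eps)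
      + L * (zeta + sigma) / (rho * delta * √eps) + L / (rho * delta)))) (fun _ => 1) T
      (fun X => ‖gradient r.loss X‖ ^ 2) eps := by
  -- Without matrix entries δ ≤ 1 may fail, but then every gradient is zero.
  rcases subsingleton_or_nontrivial (Params p q) with hsub | hnon
  · refine h.outputAccurate_of_forall_eq_zero (fun _ => one_pos) (fun x => ?_) heps.le
    rw [Subsingleton.elim (gradient r.loss x) 0, norm_zero, zero_pow two_ne_zero]
  have hrho := h.mixing.gap_pos
  have ha : 0 < rho * delta := mul_pos hrho hdelta
  have hN : (0 : ℝ) < N := by exact_mod_cast (zero_lt_one.trans h.one_lt)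
  obtain ⟨he, hA, hB, hC⟩ := stepsize_mul_le (A := L * sigma ^ 2 / (N * eps))
    (B := L * (zeta + sigma) / (rho * delta * √eps)) (C := L / (rho * delta))
    (by positivity) (by positivity) (by positivity)
  -- Because ε^(3/2) = ε √ε, the stated number of rounds is 128 Δ₀ S / ε, with S the sum in the
  -- stepsize.
  have hS : 128 * Delta0 * ((L * sigma ^ 2 / (N * eps)
      + L * (zeta + sigma) / (rho * delta * √eps) + L / (rho * delta)) / eps) ≤ T := by
    refine le_trans (le_of_eq ?_) hT
    rw [Real.rpow_three_halves heps]
    field_simp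
  have hSpos : 0 < L * sigma ^ 2 / (N * eps)
      + L * (zeta + sigma) / (rho * delta * √eps) + L / (rho * delta) := by positivity
  set S := L * sigma ^ 2 / (N * eps) + L * (zeta + sigma) / (rho * delta * √eps)
    + L / (rho * delta)
  refine h.nonconvex_outputAccurate hL hsigma hzeta hdelta (h.rho_mul_delta_le_one hdelta) hDelta
    he ?_ (nonconvex_bias_le heps he hL hsigma hzeta ha hA hB) ?_
  · rw [← mul_div_assoc, div_le_iff₀ ha] at hC
    linarith
  · have h1 : eps / 2 * (1 / (32 * S) * (T + 1)) = eps * (T + 1) / (64 * S) := by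
      field_simp; norm_num
    rw [h1, le_div_iff₀ (by positivity)]
    rw [← mul_div_assoc, div_le_iff₀ heps] at hS
    linarith

/-- Common to the convex and strongly convex cases, which differ only in how many rounds make the
total weight large enough. That requirement remains a hypothesis and may use the bounds on ρδ, μ and
the stepsize, which are established only once the space is known to be nontrivial. -/
lemma Assumptions.convex_complexity (h : r.Assumptions L sigma zeta rho delta) (hL : 0 < L)
    (hsigma : 0 ≤ sigma) (hzeta : 0 ≤ zeta) (hdelta : 0 < delta) {eps mu R : ℝ}
    (heps : 0 < eps) (hmu : 0 ≤ mu) (hconv : ∀ i, IsMuConvex mu r.loss (r.lossOf i))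
    {Xs : Params p q} (hXs : IsMinimizer r.loss Xs) (hR : ‖r.X0 - Xs‖ ≤ R) {e : ℝ}
    (he : e = 1 / (32 * (sigma ^ 2 / (N * eps)
      + √L * (zeta + sigma) / (rho * delta * √eps) + L / (rho * delta)))) {T : ℕ}
    (hT : rho * delta ≤ 1 → mu ≤ 2 * L → 0 < e → 32 * L * e ≤ rho * delta →
      R ^ 2 ≤ eps / 2 * (e * ∑ t ∈ Finset.range (T + 1), (1 + e * mu) ^ (t + 1))) :
    r.OutputAccurate (fun _ => e) (fun t => (1 + e * mu) ^ (t + 1)) T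
      (fun X => r.loss X - r.loss Xs) eps := by
  have hrho := h.mixing.gap_pos
  have ha : 0 < rho * delta := mul_pos hrho hdelta
  have hN : (0 : ℝ) < N := by exact_mod_cast (zero_lt_one.trans h.one_lt)
  obtain ⟨he0, hA, hB, hC⟩ := stepsize_mul_le (A := sigma ^ 2 / (N * eps))
    (B := √L * (zeta + sigma) / (rho * delta * √eps)) (C := L / (rho * delta))
    (by positivity) (by positivity) (by positivity)
  rw [← he] at he0 hA hB hC
  rcases subsingleton_or_nontrivial (Params p q) with hsub | hnon
  · refine h.outputAccurate_of_forall_eq_zero (fun _ => by positivity) (fun x => ?_) heps.le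
    rw [Subsingleton.elim x Xs, sub_self]
  have hstep : 32 * L * e ≤ rho * delta := by
    rw [← mul_div_assoc, div_le_iff₀ ha] at hC
    linarith
  have ha1 := h.rho_mul_delta_le_one hdelta
  exact h.convex_outputAccurate hL hsigma hzeta hdelta ha1 hmu hconv hXs hR he0 hstep
    (convex_bias_le heps he0 hL hsigma hzeta ha hA hB)
    (hT ha1 (h.mu_le hmu hconv hL hXs) he0 hstep)

end Complexity

end Run

end

/-! ### Assembly of the three cases -/

theorem theorem2 :
    ∃ c : ℝ, 0 < c ∧
      ∀ (N : ℕ) (L sigma zeta rho delta eps : ℝ), 0 ≤ L → 0 ≤ sigma → 0 ≤ zeta →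
        0 < rho → 0 < delta → 0 < eps →
        -- the non-convex case
        (∀ Delta0 : ℝ, 0 ≤ Delta0 →
          ∃ eta alpha : ℕ → ℝ, (∀ t, 0 < eta t) ∧ (∀ t, 0 ≤ alpha t) ∧
            ∀ (p q : ℕ) (Ξ : Type u) (Ω : Type v) [MeasurableSpace Ξ] [MeasurableSpace Ω]
              (r : Run N p q Ξ Ω), r.Assumptions L sigma zeta rho delta →
              (∀ Y, r.loss r.X0 - r.loss Y ≤ Delta0) →
              ∀ T : ℕ,
                c * Delta0 * (L * sigma ^ 2 / (N * eps ^ 2)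
                    + L * (zeta + sigma) / (rho * delta * eps ^ (3 / 2 : ℝ))
                    + L / (rho * delta * eps)) ≤ T →
                r.OutputAccurate eta alpha T (fun X => ‖gradient r.loss X‖ ^ 2) eps) ∧
        -- the convex case
        (∀ R : ℝ, 0 ≤ R →
          ∃ eta alpha : ℕ → ℝ, (∀ t, 0 < eta t) ∧ (∀ t, 0 ≤ alpha t) ∧
            ∀ (p q : ℕ) (Ξ : Type u) (Ω : Type v) [MeasurableSpace Ξ] [MeasurableSpace Ω]
              (r : Run N p q Ξ Ω), r.Assumptions L sigma zeta rho delta →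
              (∀ i, IsMuConvex 0 r.loss (r.lossOf i)) →
              ∀ Xs : Params p q, IsMinimizer r.loss Xs → ‖r.X0 - Xs‖ ≤ R →
              ∀ T : ℕ,
                c * R ^ 2 * (sigma ^ 2 / (N * eps ^ 2)
                    + √L * (zeta + sigma) / (rho * delta * eps ^ (3 / 2 : ℝ))
                    + L / (rho * delta * eps)) ≤ T →
                r.OutputAccurate eta alpha T (fun X => r.loss X - r.loss Xs) eps) ∧
        -- the strongly convex case
        (∀ mu R : ℝ, 0 < mu → 0 ≤ R →
          ∃ eta alpha : ℕ → ℝ, (∀ t, 0 < eta t) ∧ (∀ t, 0 ≤ alpha t) ∧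
            ∀ (p q : ℕ) (Ξ : Type u) (Ω : Type v) [MeasurableSpace Ξ] [MeasurableSpace Ω]
              (r : Run N p q Ξ Ω), r.Assumptions L sigma zeta rho delta →
              (∀ i, IsMuConvex mu r.loss (r.lossOf i)) →
              ∀ Xs : Params p q, IsMinimizer r.loss Xs → ‖r.X0 - Xs‖ ≤ R →
              ∀ T : ℕ,
                c * (sigma ^ 2 / (N * mu * eps)
                    + √L * (zeta + sigma) / (rho * delta * mu * √eps)
                    + L / (rho * delta * mu)) * Real.log (2 + mu * R ^ 2 / eps) ≤ T →
                r.OutputAccurate eta alpha T (fun X => r.loss X - r.loss Xs) eps) := by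
  -- 128 = 4 · 32, with 32 from the stepsize. The 4 comes from the factors e/2 and ε/2 in the
  -- non-convex case and from `le_sum_geometric_weights` in the strongly convex case; the convex
  -- case would need only 64.
  refine ⟨128, by norm_num, fun N L sigma zeta rho delta eps hL hsigma hzeta hrho hdelta heps =>
    ⟨fun Delta0 hDelta0 => ?_, fun R hR0 => ?_, fun mu R hmu hR0 => ?_⟩⟩
  -- For L = 0 the sum S may vanish and would give no positive stepsize. But a loss that is bounded
  -- below is then stationary everywhere, and any stepsize serves.
  · rcases hL.eq_or_lt with rfl | hL
    · refine ⟨fun _ => 1, fun _ => 1, fun _ => one_pos, fun _ => zero_le_one, ?_⟩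
      intro p q Ξ Ω _ _ r h hDelta T _
      refine h.outputAccurate_of_forall_eq_zero (fun _ => one_pos) (fun x => ?_) heps.le
      rw [h.gradient_loss_eq_zero (m := r.loss r.X0 - Delta0) fun z => by linarith [hDelta z],
        norm_zero, zero_pow two_ne_zero]
    · refine ⟨fun _ => 1 / (32 * (L * sigma ^ 2 / (N * eps)
        + L * (zeta + sigma) / (rho * delta * √eps) + L / (rho * delta))), fun _ => 1,
        fun _ => by positivity, fun _ => zero_le_one, ?_⟩
      intro p q Ξ Ω _ _ r h hDelta T hT
      exact h.nonconvex_complexity hL hsigma hzeta hdelta heps hDelta hT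
  · rcases hL.eq_or_lt with rfl | hL
    · refine ⟨fun _ => 1, fun _ => 1, fun _ => one_pos, fun _ => zero_le_one, ?_⟩
      intro p q Ξ Ω _ _ r h _ Xs hXs _ T _
      refine h.outputAccurate_of_forall_eq_zero (fun _ => one_pos) (fun x => ?_) heps.le
      rw [h.loss_eq_of_isMinimizer hXs, sub_self]
    · have hSpos : 0 < sigma ^ 2 / (N * eps)
        + √L * (zeta + sigma) / (rho * delta * √eps) + L / (rho * delta) := by positivity
      set S := sigma ^ 2 / (N * eps) + √L * (zeta + sigma) / (rho * delta * √eps)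
        + L / (rho * delta) with hS
      -- These weights are all equal to 1; the form is that of `convex_complexity` at μ = 0.
      refine ⟨fun _ => 1 / (32 * S), fun t => (1 + 1 / (32 * S) * 0) ^ (t + 1),
        fun _ => by positivity, fun _ => by positivity, ?_⟩
      intro p q Ξ Ω _ _ r h hconv Xs hXs hR T hT
      refine h.convex_complexity hL hsigma hzeta hdelta heps le_rfl hconv hXs hR rfl ?_
      intro _ _ _ _
      have hN : (0 : ℝ) < N := by exact_mod_cast (zero_lt_one.trans h.one_lt)
      have hS' : 128 * R ^ 2 * (S / eps) ≤ T := by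
        refine le_trans (le_of_eq ?_) hT
        rw [Real.rpow_three_halves heps, hS]
        field_simp
      simp only [mul_zero, add_zero, one_pow, Finset.sum_const, Finset.card_range, nsmul_eq_mul,
        mul_one]
      push_cast
      rw [← hS]
      have h1 : eps / 2 * (1 / (32 * S) * (T + 1)) = eps * (T + 1) / (64 * S) := by
        field_simp; norm_num
      rw [h1, le_div_iff₀ (by positivity)]
      rw [← mul_div_assoc, div_le_iff₀ heps] at hS'
      have : 0 ≤ R ^ 2 * S := by positivity
      linarith
  · rcases hL.eq_or_lt with rfl | hL
    · refine ⟨fun _ => 1, fun _ => 1, fun _ => one_pos, fun _ => zero_le_one, ?_⟩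
      intro p q Ξ Ω _ _ r h _ Xs hXs _ T _
      refine h.outputAccurate_of_forall_eq_zero (fun _ => one_pos) (fun x => ?_) heps.le
      rw [h.loss_eq_of_isMinimizer hXs, sub_self]
    · have hSpos : 0 < sigma ^ 2 / (N * eps)
        + √L * (zeta + sigma) / (rho * delta * √eps) + L / (rho * delta) := by positivity
      set S := sigma ^ 2 / (N * eps) + √L * (zeta + sigma) / (rho * delta * √eps)
        + L / (rho * delta) with hS
      refine ⟨fun _ => 1 / (32 * S), fun t => (1 + 1 / (32 * S) * mu) ^ (t + 1),
        fun _ => by positivity, fun _ => by positivity, ?_⟩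
      intro p q Ξ Ω _ _ r h hconv Xs hXs hR T hT
      refine h.convex_complexity hL hsigma hzeta hdelta heps hmu.le hconv hXs hR rfl ?_
      rw [← hS]
      intro ha1 hmuL he hstep
      have hN : (0 : ℝ) < N := by exact_mod_cast (zero_lt_one.trans h.one_lt)
      set e := 1 / (32 * S) with he_def
      have hS' : 128 * (S / mu) * Real.log (2 + mu * R ^ 2 / eps) ≤ T := by
        refine le_trans (le_of_eq ?_) hT
        rw [hS]
        field_simp
      have hx0 : 0 ≤ e * mu := by positivity
      -- Indeed eμ ≤ 2Le ≤ ρδ/16.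
      have hx1 : e * mu ≤ 1 := by
        have := mul_le_mul_of_nonneg_left hmuL he.le
        linarith
      have hn : 4 * Real.log (2 + mu * R ^ 2 / eps) ≤ ((T + 1 : ℕ) : ℝ) * (e * mu) := by
        have h1 := mul_le_mul_of_nonneg_right hS' hx0
        have h2 : 128 * (S / mu) * Real.log (2 + mu * R ^ 2 / eps) * (e * mu)
            = 4 * Real.log (2 + mu * R ^ 2 / eps) := by
          rw [he_def]; field_simp; ring
        rw [h2] at h1
        push_cast
        linarith
      -- Applied with x = eμ and y = μR²/ε; multiplication by ε/(2μ) turns 2y into R².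
      have key := le_sum_geometric_weights hx0 hx1 (by positivity) hn
      have key2 := mul_le_mul_of_nonneg_left key (by positivity : 0 ≤ eps / (2 * mu))
      calc R ^ 2 = eps / (2 * mu) * (2 * (mu * R ^ 2 / eps)) := by field_simp
        _ ≤ _ := key2
        _ = _ := by field_simp
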